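/- Let $\mathcal{E}$ be a weakly idempotent complete exact category in the sense of Quillen (weakly idempotent complete: every retraction has a kernel), let $\mathcal{M}\subset\mathcal{E}$ be a full additive subcategory, let $1\le k\le\infty$, and let $X\in\mathcal{E}$. Notation. Right (left) $\mathcal{M}$-modules are contravariant (covariant) additive functors from $\mathcal{M}$ to abelian groups, and $\mathrm{mod}_k\text{-}\mathcal{M}$ (resp. $\mathcal{M}\text{-}\mathrm{mod}_k$) consists of the right (resp. left) $\mathcal{M}$-modules $F$ that admit an exact sequence $Q_k\to\cdots\to Q_0\to F\to 0$ with all $Q_i$ finitely generated projective. Put $\Phi(Y)=\mathrm{Hom}_{\mathcal{E}}(-,Y)|_{\mathcal{M}}$ (a right module) and $\Psi(Y)=\mathrm{Hom}_{\mathcal{E}}(Y,-)|_{\mathcal{M}}$ (a left module). The groups $\mathrm{Tor}^i_{\mathcal{M}}(F,G)$ are the left derived functors of the tensor product $F\otimes_{\mathcal{M}}G$ of a right and a left $\mathcal{M}$-module. The subcategory $\mathrm{gen}_k^{\mathcal{E}}(\mathcal{M})$ consists of the objects $Y$ for which there is an exact sequence $0\to Z\to M_k\to\cdots\to M_0\to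 Y\to 0$ in $\mathcal{E}$ with all $M_i\in\mathcal{M}$ such that $\mathrm{Hom}_{\mathcal{E}}(M,M_k)\to\cdots\to\mathrm{Hom}_{\mathcal{E}}(M,M_0)\to\mathrm{Hom}_{\mathcal{E}}(M,Y)\to 0$ is exact for every $M\in\mathcal{M}$. Dually, $\mathrm{cogen}^k_{\mathcal{E}}(\mathcal{M})$ consists of the objects $Y$ for which there is an exact sequence $0\to Y\to M_0\to\cdots\to M_k\to Z\to 0$ in $\mathcal{E}$ with all $M_i\in\mathcal{M}$ such that $\mathrm{Hom}_{\mathcal{E}}(M_k,M)\to\cdots\to\mathrm{Hom}_{\mathcal{E}}(M_0,M)\to\mathrm{Hom}_{\mathcal{E}}(Y,M)\to 0$ is exact for every $M\in\mathcal{M}$. For $k=\infty$ the sequences are infinite ($\cdots\to Q_1\to Q_0\to F\to 0$, $\cdots\to M_1\to M_0\to Y\to 0$ and $0\to Y\to M_0\to M_1\to\cdots$). An exact sequence in $\mathcal{E}$ is one that is spliced together from conflations. (1) Suppose that $\mathcal{E}$ has enough projectives, and let $\mathcal{P}$ be the class of its projective objects. Then $X\in\mathrm{gen}_k^{\mathcal{E}}(\mathcal{M})$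 if and only if $\Phi(X)\in\mathrm{mod}_k\text{-}\mathcal{M}$ and, for every $P\in\mathcal{P}$, the composition map $$\Phi(X)\otimes_{\mathcal{M}}\Psi(P)\to\mathrm{Hom}_{\mathcal{E}}(P,X),\qquad g\otimes f\mapsto g\circ f,$$ is an isomorphism and $\mathrm{Tor}^i_{\mathcal{M}}(\Phi(X),\Psi(P))=0$ for $1\le i<k$. (2) Suppose that $\mathcal{E}$ has enough injectives, and let $\mathcal{I}$ be the class of its injective objects. Then $X\in\mathrm{cogen}^k_{\mathcal{E}}(\mathcal{M})$ if and only if $\Psi(X)\in\mathcal{M}\text{-}\mathrm{mod}_k$ and, for every $I\in\mathcal{I}$, the composition map $$\Phi(I)\otimes_{\mathcal{M}}\Psi(X)\to\mathrm{Hom}_{\mathcal{E}}(X,I),\qquad g\otimes f\mapsto g\circ f,$$ is an isomorphism and $\mathrm{Tor}^i_{\mathcal{M}}(\Phi(I),\Psi(X))=0$ for $1\le i<k$. -/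

import Mathlib

open CategoryTheory CategoryTheory.Limits

universe v u u'

/-! ### Exact categories -/

section Exact

variable (E : Type u) [Category.{v} E] [Preadditive E]

/-- An exact structure (in the sense of Quillen) on an additive category: a class of
kernel-cokernel pairs, the conflations `A ↣ B ↠ C`, closed under isomorphism, whose
first maps are the inflations and whose second maps are the deflations. -/
structure ExactStructure where
  /-- the conflations -/
  Conflation : ShortComplex E → Prop
  of_iso : ∀ {S T : ShortComplex E}, (S ≅ T) → Conflation S → Conflation T
  isKernel : ∀ {S : ShortComplex E}, Conflation S →
    Nonempty (IsLimit (KernelFork.ofι S.f S.zero))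
  isCokernel : ∀ {S : ShortComplex E}, Conflation S →
    Nonempty (IsColimit (CokernelCofork.ofπ S.g S.zero))
  id_inflation : ∀ A : E, ∃ (C : E) (p : A ⟶ C) (w : 𝟙 A ≫ p = 0),
    Conflation (ShortComplex.mk (𝟙 A) p w)
  id_deflation : ∀ A : E, ∃ (K : E) (i : K ⟶ A) (w : i ≫ 𝟙 A = 0),
    Conflation (ShortComplex.mk i (𝟙 A) w)
  comp_inflation : ∀ {A B C : E} (i : A ⟶ B) (j : B ⟶ C),
    (∃ (D : E) (p : B ⟶ D) (w : i ≫ p = 0), Conflation (ShortComplex.mk i p w)) →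
    (∃ (D : E) (p : C ⟶ D) (w : j ≫ p = 0), Conflation (ShortComplex.mk j p w)) →
    ∃ (D : E) (p : C ⟶ D) (w : (i ≫ j) ≫ p = 0), Conflation (ShortComplex.mk (i ≫ j) p w)
  comp_deflation : ∀ {A B C : E} (p : A ⟶ B) (q : B ⟶ C),
    (∃ (K : E) (i : K ⟶ A) (w : i ≫ p = 0), Conflation (ShortComplex.mk i p w)) →
    (∃ (K : E) (i : K ⟶ B) (w : i ≫ q = 0), Conflation (ShortComplex.mk i q w)) →
    ∃ (K : E) (i : K ⟶ A) (w : i ≫ p ≫ q = 0), Conflation (ShortComplex.mk i (p ≫ q) w)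
  pushout_inflation : ∀ {A B A' : E} (i : A ⟶ B) (f : A ⟶ A'),
    (∃ (D : E) (p : B ⟶ D) (w : i ≫ p = 0), Conflation (ShortComplex.mk i p w)) →
    ∃ (B' : E) (i' : A' ⟶ B') (f' : B ⟶ B'), IsPushout i f f' i' ∧
      ∃ (D : E) (p : B' ⟶ D) (w : i' ≫ p = 0), Conflation (ShortComplex.mk i' p w)
  pullback_deflation : ∀ {B C C' : E} (p : B ⟶ C) (f : C' ⟶ C),
    (∃ (K : E) (i : K ⟶ B) (w : i ≫ p = 0), Conflation (ShortComplex.mk i p w)) →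
    ∃ (B' : E) (p' : B' ⟶ C') (f' : B' ⟶ B), IsPullback f' p' p f ∧
      ∃ (K : E) (i : K ⟶ B') (w : i ≫ p' = 0), Conflation (ShortComplex.mk i p' w)

/-- Every retraction has a kernel (equivalently, every coretraction has a cokernel). -/
def WeaklyIdempotentComplete : Prop :=
  ∀ ⦃A B : E⦄ (r : A ⟶ B) (s : B ⟶ A), s ≫ r = 𝟙 B → HasKernel r

variable {E}

namespace ExactStructure

variable (S : ExactStructure E)

/-- `i` is the first map of a conflation. -/
def Inflation {A B : E} (i : A ⟶ B) : Prop :=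
  ∃ (C : E) (p : B ⟶ C) (w : i ≫ p = 0), S.Conflation (ShortComplex.mk i p w)

/-- `p` is the second map of a conflation. -/
def Deflation {B C : E} (p : B ⟶ C) : Prop :=
  ∃ (A : E) (i : A ⟶ B) (w : i ≫ p = 0), S.Conflation (ShortComplex.mk i p w)

/-- `P` is projective: maps out of `P` lift along deflations. -/
def IsProjective (P : E) : Prop :=
  ∀ ⦃B C : E⦄ (p : B ⟶ C), S.Deflation p → ∀ f : P ⟶ C, ∃ g : P ⟶ B, g ≫ p = f

/-- `I` is injective: maps into `I` extend along inflations. -/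
def IsInjective (I : E) : Prop :=
  ∀ ⦃A B : E⦄ (i : A ⟶ B), S.Inflation i → ∀ f : A ⟶ I, ∃ g : B ⟶ I, i ≫ g = f

/-- Every object is the target of a deflation from a projective object. -/
def HasEnoughProjectives : Prop :=
  ∀ X : E, ∃ (P : E) (p : P ⟶ X), S.IsProjective P ∧ S.Deflation p

/-- Every object is the source of an inflation into an injective object. -/
def HasEnoughInjectives : Prop :=
  ∀ X : E, ∃ (I : E) (i : X ⟶ I), S.IsInjective I ∧ S.Inflation i

/-- An exact sequence `0 → Z (k+1) → A k → ⋯ → A 1 → A 0 → X → 0` in the exact category, given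
by the conflations `Z (i+1) ↣ A i ↠ Z i`, `i ≤ k`, into which it decomposes, with `Z 0 ≅ X`.
For `k = ⊤` it is an exact sequence `⋯ → A 1 → A 0 → X → 0`. The terms that do not occur
in the sequence are irrelevant. -/
structure LeftSequence (k : ℕ∞) (X : E) where
  /-- the terms -/
  A : ℕ → E
  /-- the syzygies -/
  Z : ℕ → E
  /-- the last syzygy is `X` -/
  e : Z 0 ≅ X
  /-- the inflations -/
  ι : ∀ i, Z (i + 1) ⟶ A i
  /-- the deflations -/
  π : ∀ i, A i ⟶ Z i
  w : ∀ i, ι i ≫ π i = 0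
  conflation : ∀ i : ℕ, (i : ℕ∞) ≤ k → S.Conflation (ShortComplex.mk (ι i) (π i) (w i))

namespace LeftSequence

variable {S} {k : ℕ∞} {X : E} (T : S.LeftSequence k X)

/-- The map `A 0 → X`. -/
def aug : T.A 0 ⟶ X := T.π 0 ≫ T.e.hom

/-- The map `A (i+1) → A i`. -/
def d (i : ℕ) : T.A (i + 1) ⟶ T.A i := T.π (i + 1) ≫ T.ι i

end LeftSequence

/-- An exact sequence `0 → X → A 0 → A 1 → ⋯ → A k → Z (k+1) → 0` in the exact category, given
by the conflations `Z i ↣ A i ↠ Z (i+1)`, `i ≤ k`, into which it decomposes, with `X ≅ Z 0`.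
For `k = ⊤` it is an exact sequence `0 → X → A 0 → A 1 → ⋯`. -/
structure RightSequence (k : ℕ∞) (X : E) where
  /-- the terms -/
  A : ℕ → E
  /-- the cosyzygies -/
  Z : ℕ → E
  /-- the first cosyzygy is `X` -/
  e : X ≅ Z 0
  /-- the inflations -/
  ι : ∀ i, Z i ⟶ A i
  /-- the deflations -/
  π : ∀ i, A i ⟶ Z (i + 1)
  w : ∀ i, ι i ≫ π i = 0
  conflation : ∀ i : ℕ, (i : ℕ∞) ≤ k → S.Conflation (ShortComplex.mk (ι i) (π i) (w i))

namespace RightSequence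

variable {S} {k : ℕ∞} {X : E} (T : S.RightSequence k X)

/-- The map `X → A 0`. -/
def coaug : X ⟶ T.A 0 := T.e.hom ≫ T.ι 0

/-- The map `A i → A (i+1)`. -/
def d (i : ℕ) : T.A i ⟶ T.A (i + 1) := T.π i ≫ T.ι (i + 1)

end RightSequence

/-- The full subcategory `gen_k(M)`: objects `X` with an exact sequence
`0 → Z → A k → ⋯ → A 0 → X → 0`, all `A i` in `M`, such that for all `N` in `M` the sequence
`Hom(N, A k) → ⋯ → Hom(N, A 0) → Hom(N, X) → 0` is exact. -/
def gen (k : ℕ∞) (M : ObjectProperty E) : ObjectProperty E := fun X =>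
  ∃ T : S.LeftSequence k X, (∀ i : ℕ, (i : ℕ∞) ≤ k → M (T.A i)) ∧
    ∀ N : E, M N →
      Function.Surjective (fun f : N ⟶ T.A 0 => f ≫ T.aug) ∧
      (0 < k → Function.Exact (fun f : N ⟶ T.A 1 => f ≫ T.d 0)
        (fun f : N ⟶ T.A 0 => f ≫ T.aug)) ∧
      ∀ i : ℕ, ((i + 1 : ℕ) : ℕ∞) < k →
        Function.Exact (fun f : N ⟶ T.A (i + 2) => f ≫ T.d (i + 1))
          (fun f : N ⟶ T.A (i + 1) => f ≫ T.d i)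

/-- The full subcategory `cogen^k(M)`: objects `X` with an exact sequence
`0 → X → A 0 → ⋯ → A k → Z → 0`, all `A i` in `M`, such that for all `N` in `M` the sequence
`Hom(A k, N) → ⋯ → Hom(A 0, N) → Hom(X, N) → 0` is exact. -/
def cogen (k : ℕ∞) (M : ObjectProperty E) : ObjectProperty E := fun X =>
  ∃ T : S.RightSequence k X, (∀ i : ℕ, (i : ℕ∞) ≤ k → M (T.A i)) ∧
    ∀ N : E, M N →
      Function.Surjective (fun f : T.A 0 ⟶ N => T.coaug ≫ f) ∧
      (0 < k → Function.Exact (fun f : T.A 1 ⟶ N => T.d 0 ≫ f)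
        (fun f : T.A 0 ⟶ N => T.coaug ≫ f)) ∧
      ∀ i : ℕ, ((i + 1 : ℕ) : ℕ∞) < k →
        Function.Exact (fun f : T.A (i + 2) ⟶ N => T.d (i + 1) ≫ f)
          (fun f : T.A (i + 1) ⟶ N => T.d i ≫ f)

end ExactStructure

end Exact

/-! ### Modules over a preadditive category -/

/-- The category of left `C`-modules: additive functors from `C` to abelian groups. Right
`C`-modules are left `Cᵒᵖ`-modules. The abelian groups live in a universe that contains both
the objects and the morphisms of `C`, so that `C` need not be essentially small. -/
abbrev LeftMod (C : Type u) [Category.{v} C] [Preadditive C] :=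
  C ⥤+ AddCommGrpCat.{max u v}

/-- The category of right `C`-modules: contravariant additive functors to abelian groups. -/
abbrev RightMod (C : Type u) [Category.{v} C] [Preadditive C] := LeftMod.{v, u} Cᵒᵖ

section Modules

variable {C : Type u} [Category.{v} C] [Preadditive C]

section Abelian

variable (C) (D : Type u') [Category.{max u v} D] [Abelian D]

instance : (additiveFunctor C D).IsClosedUnderSubobjects where
  prop_of_mono {F G} i _ hG := by
    have : G.Additive := hG
    exact ⟨fun {X Y f g} => by
      rw [← cancel_mono (i.app Y)]
      simp [Preadditive.add_comp, Preadditive.comp_add]⟩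

instance : (additiveFunctor C D).IsClosedUnderQuotients where
  prop_of_epi {F G} p _ hF := by
    have : F.Additive := hF
    exact ⟨fun {X Y f g} => by
      rw [← cancel_epi (p.app X)]
      simp [← NatTrans.naturality, Preadditive.add_comp, Preadditive.comp_add]⟩

instance : (additiveFunctor C D).ContainsZero where
  exists_zero := ⟨_, isZero_zero (C ⥤ D), Functor.Additive.of_isZero (isZero_zero _)⟩

instance : (additiveFunctor C D).IsClosedUnderFiniteProducts where
  isClosedUnderLimitsOfShape J _ := by
    refine ⟨?_⟩
    rintro F ⟨h⟩
    refine ⟨fun {X Y f g} => ?_⟩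
    refine (isLimitOfPreserves ((evaluation C D).obj Y) h.isLimit).hom_ext fun j => ?_
    have : (h.diag.obj j).Additive := h.prop_diag_obj j
    simp [Preadditive.add_comp]

instance (J : Type (max u v)) [HasCoproducts.{max u v} D] :
    (additiveFunctor C D).IsClosedUnderColimitsOfShape (Discrete J) := by
  refine ⟨?_⟩
  rintro F ⟨h⟩
  refine ⟨fun {X Y f g} => ?_⟩
  refine (isColimitOfPreserves ((evaluation C D).obj X) h.isColimit).hom_ext fun j => ?_
  have : (h.diag.obj j).Additive := h.prop_diag_obj j
  simp [← NatTrans.naturality, Preadditive.comp_add]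

end Abelian

/-- For an additive functor `J : C ⥤ E`, the left `C`-module `c ↦ Hom(X, J c)`. -/
def homFrom {E : Type u'} [Category.{v} E] [Preadditive E] (J : C ⥤ E) [J.Additive] (X : E) :
    LeftMod.{v, u} C where
  obj :=
    { obj := fun c => AddCommGrpCat.of (ULift.{max u v} (X ⟶ J.obj c))
      map := fun {_ _} f => AddCommGrpCat.ofHom
        { toFun := fun g => ⟨g.down ≫ J.map f⟩
          map_zero' := by ext; simp
          map_add' := fun _ _ => by ext; simp [Preadditive.add_comp] }
      map_id := fun _ => by ext; simp
      map_comp := fun _ _ => by ext; simp }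
  property := ⟨fun {_ _ _ _} => by ext; simp [Preadditive.comp_add]⟩

/-- For an additive functor `J : C ⥤ E`, the right `C`-module `c ↦ Hom(J c, X)`. -/
def homTo {E : Type u'} [Category.{v} E] [Preadditive E] (J : C ⥤ E) [J.Additive] (X : E) :
    RightMod.{v, u} C where
  obj :=
    { obj := fun c => AddCommGrpCat.of (ULift.{max u v} (J.obj c.unop ⟶ X))
      map := fun {_ _} f => AddCommGrpCat.ofHom
        { toFun := fun g => ⟨J.map f.unop ≫ g.down⟩
          map_zero' := by ext; simp
          map_add' := fun _ _ => by ext; simp [Preadditive.comp_add] }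
      map_id := fun _ => by ext; simp
      map_comp := fun _ _ => by ext; simp }
  property := ⟨fun {_ _ _ _} => by ext; simp [Preadditive.add_comp]⟩

/-- The map `Hom(c, -) ⟶ F` given by an element of `F c`. -/
def ofElement (F : LeftMod.{v, u} C) (c : C) (x : F.obj.obj c) : homFrom (𝟭 C) c ⟶ F :=
  ObjectProperty.homMk
    { app := fun d => AddCommGrpCat.ofHom
        { toFun := fun g => F.obj.map g.down x
          map_zero' := by simp
          map_add' := fun _ _ => by simp }
      naturality := fun _ _ f => by
        ext g
        change F.obj.map (g.down ≫ f) x = F.obj.map f (F.obj.map g.down x)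
        simp }

lemma leftMod_epi_iff {F G : LeftMod.{v, u} C} (p : F ⟶ G) :
    Epi p ↔ ∀ c, Function.Surjective (p.hom.app c) := by
  have := (additiveFunctor C AddCommGrpCat.{max u v}).preservesEpimorphisms_ι_of_isNormalMonoCategory
  have h : Epi p ↔ Epi p.hom :=
    ⟨fun _ => inferInstanceAs (Epi ((additiveFunctor C AddCommGrpCat.{max u v}).ι.map p)),
     fun h => (additiveFunctor C AddCommGrpCat.{max u v}).ι.epi_of_epi_map h⟩
  rw [h, NatTrans.epi_iff_epi_app]
  simp only [AddCommGrpCat.epi_iff_surjective]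

instance (c : C) : Projective (homFrom (𝟭 C) c) where
  factors {F G} f p hp := by
    rw [leftMod_epi_iff] at hp
    obtain ⟨y, hy⟩ := hp c (f.hom.app c ⟨𝟙 c⟩)
    refine ⟨ofElement F c y, ?_⟩
    ext d g
    change p.hom.app d (F.obj.map g.down y) = f.hom.app d g
    have h₁ := ConcreteCategory.congr_hom (p.hom.naturality g.down) y
    have h₂ := ConcreteCategory.congr_hom (f.hom.naturality g.down) ⟨𝟙 c⟩
    refine h₁.trans ((congrArg (G.obj.map g.down) hy).trans (h₂.symm.trans ?_))
    exact congrArg (f.hom.app d) (ULift.ext _ _ (Category.id_comp _))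

instance : EnoughProjectives (LeftMod.{v, u} C) where
  presentation F := by
    let Q : (Σ c : C, F.obj.obj c) → LeftMod.{v, u} C := fun s => homFrom (𝟭 C) s.1
    refine ⟨{ p := ∐ Q, f := Sigma.desc fun s => ofElement F s.1 s.2, epi := ?_ }⟩
    rw [leftMod_epi_iff]
    intro c x
    refine ⟨(Sigma.ι Q ⟨c, x⟩).hom.app c ⟨𝟙 c⟩, ?_⟩
    have h := ConcreteCategory.congr_hom (NatTrans.congr_app (congrArg (fun f => f.hom)
      (Sigma.ι_desc (fun s => ofElement F s.1 s.2) (⟨c, x⟩ : Σ c : C, F.obj.obj c))) c) ⟨𝟙 c⟩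
    refine h.trans ?_
    change F.obj.map (𝟙 c) x = x
    simp

/-- Finitely generated modules. -/
def LeftMod.FG (F : LeftMod.{v, u} C) : Prop :=
  ∃ (n : ℕ) (c : Fin n → C) (x : ∀ i, F.obj.obj (c i)), ∀ (d : C) (y : F.obj.obj d),
    ∃ f : ∀ i, c i ⟶ d, y = ∑ i, F.obj.map (f i) (x i)

/-- `mod_k`: the modules `F` with a `k`-presentation, that is an exact sequence
`Q k → ⋯ → Q 1 → Q 0 → F → 0`, by finitely generated projectives. For `k = ⊤` this is an exact
sequence `⋯ → Q 1 → Q 0 → F → 0`. -/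
def LeftMod.IsPresented (k : ℕ∞) (F : LeftMod.{v, u} C) : Prop :=
  ∃ (Q : ℕ → LeftMod.{v, u} C) (d : ∀ i, Q (i + 1) ⟶ Q i) (ε : Q 0 ⟶ F),
    (∀ i : ℕ, (i : ℕ∞) ≤ k → Projective (Q i) ∧ (Q i).FG) ∧
    Epi ε ∧
    (0 < k → ∃ w : d 0 ≫ ε = 0, (ShortComplex.mk (d 0) ε w).Exact) ∧
    ∀ i : ℕ, ((i + 1 : ℕ) : ℕ∞) < k →
      ∃ w : d (i + 1) ≫ d i = 0, (ShortComplex.mk (d (i + 1)) (d i) w).Exact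

/-! ### Tensor products and Tor -/

section Tensor

variable (F : RightMod.{v, u} C) (G : LeftMod.{v, u} C)

/-- The relations defining the tensor product: biadditivity, and `x f ⊗ y = x ⊗ f y` for all
`f : c ⟶ d`, `x ∈ F d`, `y ∈ G c`. -/
inductive TensorRel :
    FreeAbelianGroup (Σ c : C, F.obj.obj (Opposite.op c) × G.obj.obj c) → Prop
  | add_left (c : C) (x x' : F.obj.obj (Opposite.op c)) (y : G.obj.obj c) :
      TensorRel (.of ⟨c, x + x', y⟩ - (.of ⟨c, x, y⟩ + .of ⟨c, x', y⟩))
  | add_right (c : C) (x : F.obj.obj (Opposite.op c)) (y y' : G.obj.obj c) :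
      TensorRel (.of ⟨c, x, y + y'⟩ - (.of ⟨c, x, y⟩ + .of ⟨c, x, y'⟩))
  | balanced (c d : C) (f : c ⟶ d) (x : F.obj.obj (Opposite.op d)) (y : G.obj.obj c) :
      TensorRel (.of ⟨c, F.obj.map f.op x, y⟩ - .of ⟨d, x, G.obj.map f y⟩)

/-- The tensor product `F ⊗_C G` of a right and a left `C`-module. -/
abbrev TensorObj : Type (max u v) :=
  FreeAbelianGroup (Σ c : C, F.obj.obj (Opposite.op c) × G.obj.obj c) ⧸
    AddSubgroup.closure {r | TensorRel F G r}

variable {F G}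

/-- The element `x ⊗ y`, for `x ∈ F c` and `y ∈ G c`. -/
def tmul {c : C} (x : F.obj.obj (Opposite.op c)) (y : G.obj.obj c) : TensorObj F G :=
  QuotientAddGroup.mk (FreeAbelianGroup.of ⟨c, x, y⟩)

/-- The homomorphism out of the tensor product given by a balanced biadditive map. -/
def tensorLift {A : Type*} [AddCommGroup A]
    (φ : ∀ c : C, F.obj.obj (Opposite.op c) → G.obj.obj c → A)
    (add_left : ∀ c x x' y, φ c (x + x') y = φ c x y + φ c x' y)
    (add_right : ∀ c x y y', φ c x (y + y') = φ c x y + φ c x y')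
    (balanced : ∀ (c d : C) (f : c ⟶ d) (x : F.obj.obj (Opposite.op d)) (y : G.obj.obj c),
      φ c (F.obj.map f.op x) y = φ d x (G.obj.map f y)) : TensorObj F G →+ A :=
  QuotientAddGroup.lift _ (FreeAbelianGroup.lift fun s => φ s.1 s.2.1 s.2.2) (by
    rw [AddSubgroup.closure_le]
    rintro r (⟨c, x, x', y⟩ | ⟨c, x, y, y'⟩ | ⟨c, d, f, x, y⟩)
    · simp [add_left]
    · simp [add_right]
    · simp [balanced])

@[simp]
lemma tensorLift_tmul {A : Type*} [AddCommGroup A]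
    (φ : ∀ c : C, F.obj.obj (Opposite.op c) → G.obj.obj c → A) (h₁ h₂ h₃) {c : C}
    (x : F.obj.obj (Opposite.op c)) (y : G.obj.obj c) :
    tensorLift φ h₁ h₂ h₃ (tmul x y) = φ c x y := by
  simp [tensorLift, tmul]

lemma tmul_add_left {c : C} (x x' : F.obj.obj (Opposite.op c)) (y : G.obj.obj c) :
    (tmul (x + x') y : TensorObj F G) = tmul x y + tmul x' y :=
  (QuotientAddGroup.eq_iff_sub_mem.2 (AddSubgroup.subset_closure (.add_left c x x' y)))

lemma tmul_add_right {c : C} (x : F.obj.obj (Opposite.op c)) (y y' : G.obj.obj c) :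
    (tmul x (y + y') : TensorObj F G) = tmul x y + tmul x y' :=
  (QuotientAddGroup.eq_iff_sub_mem.2 (AddSubgroup.subset_closure (.add_right c x y y')))

lemma tmul_balanced {c d : C} (f : c ⟶ d) (x : F.obj.obj (Opposite.op d)) (y : G.obj.obj c) :
    (tmul (F.obj.map f.op x) y : TensorObj F G) = tmul x (G.obj.map f y) :=
  (QuotientAddGroup.eq_iff_sub_mem.2 (AddSubgroup.subset_closure (.balanced c d f x y)))

lemma tensor_hom_ext {A : Type*} [AddCommGroup A] {f g : TensorObj F G →+ A}
    (h : ∀ (c : C) (x : F.obj.obj (Opposite.op c)) (y : G.obj.obj c),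
      f (tmul x y) = g (tmul x y)) : f = g := by
  refine QuotientAddGroup.addMonoidHom_ext _ (FreeAbelianGroup.lift_ext _ _ ?_)
  rintro ⟨c, x, y⟩
  exact h c x y

variable (G)

/-- The functor `- ⊗_C G` from right `C`-modules to abelian groups. -/
def tensorRight : RightMod.{v, u} C ⥤ AddCommGrpCat.{max u v} where
  obj F := AddCommGrpCat.of (TensorObj F G)
  map {F F'} α := AddCommGrpCat.ofHom (tensorLift (fun c x y => tmul (α.hom.app _ x) y)
    (fun c x x' y => by simp [tmul_add_left]) (fun c x y y' => by simp [tmul_add_right])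
    (fun c d f x y => by
      rw [← tmul_balanced]
      congr 1
      exact ConcreteCategory.congr_hom (α.hom.naturality f.op) x))
  map_id F := by
    ext : 1
    refine tensor_hom_ext fun c x y => ?_
    simp
  map_comp α β := by
    ext : 1
    refine tensor_hom_ext fun c x y => ?_
    simp

instance : (tensorRight G).Additive where
  map_add {F F' α β} := by
    ext : 1
    refine tensor_hom_ext fun c x y => ?_
    change tmul (α.hom.app _ x + β.hom.app _ x) y = tmul (α.hom.app _ x) y + tmul (β.hom.app _ x) y
    exact tmul_add_left _ _ _

/-- `Tor_i^C(F, G)`: the `i`-th left derived functor of `- ⊗_C G` at `F`. -/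
noncomputable def TorMod (i : ℕ) (F : RightMod.{v, u} C) (G : LeftMod.{v, u} C) :
    AddCommGrpCat.{max u v} :=
  ((tensorRight G).leftDerived i).obj F

end Tensor

end Modules

/-! ### The functors `Φ` and `Ψ` -/

section PhiPsi

variable {E : Type u} [Category.{v} E] [Preadditive E] (M : ObjectProperty E)

/-- The right `M`-module `Φ(X) = Hom(-, X)|_M`. -/
def Phi (X : E) : RightMod.{v, u} M.FullSubcategory := homTo M.ι X

/-- The left `M`-module `Ψ(X) = Hom(X, -)|_M`. -/
def Psi (X : E) : LeftMod.{v, u} M.FullSubcategory := homFrom M.ι X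

/-- The map `Φ(X) ⊗_M Ψ(Y) → Hom(Y, X)`, `g ⊗ f ↦ g ∘ f`, where `g : N ⟶ X` and `f : Y ⟶ N`
with `N` in `M`. -/
def compositionMap (X Y : E) : TensorObj (Phi M X) (Psi M Y) →+ (Y ⟶ X) :=
  tensorLift (fun _ g f => f.down ≫ g.down)
    (fun _ _ _ _ => Preadditive.comp_add _ _ _ _ _ _)
    (fun _ _ _ _ => Preadditive.add_comp _ _ _ _ _ _)
    (fun _ _ _ _ _ => (Category.assoc _ _ _).symm)

end PhiPsi

/-!
Testing exactness on projective objects shows that `X` lies in `gen_k(M)` if and only if there is a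
complex `⋯ → A 1 → A 0 → X` with all `A i` in `M` that both the functors `Hom(N, -)`, for `N` in
`M`, and the functors `Hom(P, -)`, for `P` projective, turn into exact sequences ending in zero: in
a weakly idempotent complete category, a morphism through which a deflation factors is a deflation,
so that the complex splices into conflations. Exactness for the `N` in `M` says that the complex is
a presentation of `Φ(X)` by representable modules, and as `M` has finite direct sums, every module
in `mod_k` has such a presentation. Tensoring it with `Ψ(P)` yields the sequence `Hom(P, A i)` by
the co-Yoneda lemma. That sequence is exact if and only if the composition map is bijective, by
right exactness of the tensor product, and `Tor` vanishes in the degrees `1 ≤ i < k`, by dimension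
shifting along the presentation.

Part (2) is dual: the categories are replaced by the opposite exact categories, and `Tor` has to be
read off a presentation of its second variable. As in the balancing of `Tor`, this rests on
dimension shifting along `0 → G' → Hom(c, -) → G → 0`, which needs that projective modules are flat.
-/

/-! ### Vanishing of left derived functors -/

section DerivedFunctors

variable {A : Type*} [Category* A] [Abelian A]

lemma exact_epi_comp_iff {W X Y Z : A} (e : W ⟶ X) [Epi e] {f : X ⟶ Y} {g : Y ⟶ Z}
    (w : f ≫ g = 0) (w' : (e ≫ f) ≫ g = 0) :
    (ShortComplex.mk (e ≫ f) g w').Exact ↔ (ShortComplex.mk f g w).Exact :=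
  ShortComplex.exact_iff_of_epi_of_isIso_of_mono
    { τ₁ := e, τ₂ := 𝟙 _, τ₃ := 𝟙 _ : ShortComplex.mk (e ≫ f) g w' ⟶ ShortComplex.mk f g w }

lemma exact_comp_mono_iff {W X Y Z : A} {f : W ⟶ X} {g : X ⟶ Y} (m : Y ⟶ Z) [Mono m]
    (w : f ≫ g = 0) (w' : f ≫ g ≫ m = 0) :
    (ShortComplex.mk f (g ≫ m) w').Exact ↔ (ShortComplex.mk f g w).Exact :=
  (ShortComplex.exact_iff_of_epi_of_isIso_of_mono
    { τ₁ := 𝟙 _, τ₂ := 𝟙 _, τ₃ := m : ShortComplex.mk f g w ⟶ ShortComplex.mk f (g ≫ m) w' }).symm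

lemma exact_comp_iff_mono {W X Y Z : A} {f : W ⟶ X} {g : X ⟶ Y} [Epi g] {w : f ≫ g = 0}
    (hfg : (ShortComplex.mk f g w).Exact) (m : Y ⟶ Z) (w' : f ≫ g ≫ m = 0) :
    (ShortComplex.mk f (g ≫ m) w').Exact ↔ Mono m := by
  refine ⟨fun h => ?_, fun _ => (exact_comp_mono_iff m w w').2 hfg⟩
  have hg : IsIso (cokernel.desc f g w) := by
    have : Mono (cokernel.desc f g w) := hfg.mono_cokernelDesc
    have : Epi (cokernel.desc f g w) := epi_of_epi_fac (cokernel.π_desc f g w)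
    exact isIso_of_mono_of_epi _
  have hm : Mono (cokernel.desc f g w ≫ m) := by
    have : cokernel.desc f g w ≫ m = cokernel.desc f (g ≫ m) w' := by
      rw [← cancel_epi (cokernel.π f), cokernel.π_desc, cokernel.π_desc_assoc]
    rw [this]
    exact h.mono_cokernelDesc
  rw [← IsIso.inv_hom_id_assoc (cokernel.desc f g w) m]
  exact mono_comp _ _

lemma comp_comp_eq_zero {W X Y Z : A} {f : W ⟶ X} {g : X ⟶ Y} (w : f ≫ g = 0) (h : Y ⟶ Z) :
    f ≫ g ≫ h = 0 := by
  rw [reassoc_of% w, zero_comp]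

/-- The projective resolution of `S.X₃` that a projective resolution of `S.X₁` and a short exact
sequence `0 → S.X₁ → S.X₂ → S.X₃ → 0` with `S.X₂` projective give by splicing. -/
noncomputable def splicedResolution {S : ShortComplex A} (hS : S.ShortExact) [Projective S.X₂]
    (R : ProjectiveResolution S.X₁) : ProjectiveResolution S.X₃ where
  complex := ChainComplex.augment R.complex (R.π.f 0 ≫ S.f)
    (comp_comp_eq_zero R.complex_d_comp_π_f_zero S.f)
  projective n := by
    cases n
    · assumption
    · exact R.projective _
  π := (ChainComplex.toSingle₀Equiv _ _).symm
    ⟨S.g, (Category.assoc (R.π.f 0) S.f S.g).trans ((congrArg _ S.zero).trans comp_zero)⟩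
  quasiIso := ⟨fun n => by
    cases n with
    | zero =>
      rw [ChainComplex.quasiIsoAt₀_iff, ShortComplex.quasiIso_iff_of_zeros' _ rfl rfl rfl]
      refine (ShortComplex.exact_and_epi_g_iff_of_iso ?_).2
        ⟨(exact_epi_comp_iff (R.π.f 0) S.zero
          ((Category.assoc _ _ _).trans ((congrArg _ S.zero).trans comp_zero))).2 hS.exact,
          hS.epi_g⟩
      exact ShortComplex.isoMk (Iso.refl _) (Iso.refl _) (Iso.refl _)
        ((Category.id_comp (R.π.f 0 ≫ S.f)).trans (Category.comp_id (R.π.f 0 ≫ S.f)).symm)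
        ((Category.id_comp S.g).trans (Eq.trans (ChainComplex.toSingle₀Equiv_symm_apply_f_zero
          (C := R.complex.augment (R.π.f 0 ≫ S.f) _) S.g _).symm (Category.comp_id _).symm))
    | succ n =>
      rw [quasiIsoAt_iff_exactAt' _ _ (ChainComplex.exactAt_succ_single_obj _ _),
        HomologicalComplex.exactAt_iff' _ (n + 2) (n + 1) n (by simp) (by simp)]
      cases n with
      | zero =>
        have := hS.mono_f
        exact (exact_comp_mono_iff S.f R.complex_d_comp_π_f_zero _).2 R.exact₀
      | succ n => exact R.exact_succ n⟩

variable {B : Type*} [Category* B] [Abelian B]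

lemma exact_map_comp_iff_mono_map (T : A ⥤ B) [T.PreservesZeroMorphisms]
    [PreservesFiniteColimits T] {W X Y Z : A} {f : W ⟶ X} {g : X ⟶ Y} [Epi g] {w : f ≫ g = 0}
    (hfg : (ShortComplex.mk f g w).Exact) (m : Y ⟶ Z) (w' : f ≫ g ≫ m = 0) :
    ((ShortComplex.mk f (g ≫ m) w').map T).Exact ↔ Mono (T.map m) := by
  have hT := hfg.map_of_epi_of_preservesCokernel T ‹_› inferInstance
  rw [← exact_comp_iff_mono (A := B) hT (T.map m)
    (comp_comp_eq_zero ((ShortComplex.mk f g w).map T).zero _)]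
  simp only [ShortComplex.map, T.map_comp]

lemma exists_syzygy {W X Y Z : A} {e : W ⟶ X} {f : X ⟶ Y} {g : Y ⟶ Z} [Epi g]
    (hfg : ∃ w, (ShortComplex.mk f g w).Exact) (hef : ∃ w, (ShortComplex.mk e f w).Exact) :
    ∃ (K : A) (κ : K ⟶ Y) (w : κ ≫ g = 0) (p : X ⟶ K), (ShortComplex.mk κ g w).ShortExact ∧
      Epi p ∧ p ≫ κ = f ∧ ∃ w, (ShortComplex.mk e p w).Exact := by
  obtain ⟨w, hfg⟩ := hfg
  obtain ⟨w', hef⟩ := hef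
  have w'' : e ≫ kernel.lift g f w = 0 := by simp [← cancel_mono (kernel.ι g), w']
  refine ⟨kernel g, kernel.ι g, kernel.condition g, kernel.lift g f w,
    { exact := ShortComplex.exact_kernel g }, (ShortComplex.exact_iff_epi_kernel_lift _).1 hfg,
    kernel.lift_ι g f w, w'', (exact_comp_mono_iff (kernel.ι g) w'' (by simp [w'])).1 ?_⟩
  simpa only [kernel.lift_ι] using hef

section DimensionShift

variable {T : A ⥤ B} [T.Additive] [PreservesFiniteColimits T] {𝒬 : ObjectProperty A}
  {Z : ℕ → ObjectProperty A}

-- `Z n` stands for the vanishing of the `n`-th left derived functor of `T`, or of `Tor` in its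
-- other variable.
theorem vanishing_iff_exact_map
    (mono_iff : ∀ S : ShortComplex A, S.ShortExact → 𝒬 S.X₂ → (Z 1 S.X₃ ↔ Mono (T.map S.f)))
    (shift_iff : ∀ S : ShortComplex A, S.ShortExact → 𝒬 S.X₂ →
      ∀ n, Z (n + 2) S.X₃ ↔ Z (n + 1) S.X₁)
    (n : ℕ) {X : A} {Q : ℕ → A} {d : ∀ i, Q (i + 1) ⟶ Q i} {ε : Q 0 ⟶ X}
    (hQ : ∀ i ≤ n, 𝒬 (Q i)) (hε : Epi ε) (h₀ : ∃ w, (ShortComplex.mk (d 0) ε w).Exact)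
    (h : ∀ i ≤ n, ∃ w, (ShortComplex.mk (d (i + 1)) (d i) w).Exact) :
    Z (n + 1) X ↔ ∃ w, (ShortComplex.mk (T.map (d (n + 1))) (T.map (d n)) w).Exact := by
  induction n generalizing X Q with
  | zero =>
    obtain ⟨K, κ, w, p, hS, hp, hpκ, w', hd⟩ := exists_syzygy h₀ (h 0 le_rfl)
    rw [mono_iff _ hS (hQ 0 le_rfl), ← exact_map_comp_iff_mono_map T hd κ
      (comp_comp_eq_zero w' _)]
    simp only [hpκ]
    exact ⟨fun h => ⟨_, h⟩, fun ⟨_, h⟩ => h⟩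
  | succ n ih =>
    obtain ⟨K, κ, w, p, hS, hp, -, hd⟩ := exists_syzygy h₀ (h 0 n.succ.zero_le)
    rw [shift_iff _ hS (hQ 0 n.succ.zero_le)]
    exact ih (d := fun i => d (i + 1)) (fun i hi => hQ (i + 1) (by omega)) hp hd
      (fun i hi => h (i + 1) (by omega))

end DimensionShift

/-- A right exact functor is computed by the homology in degree zero of a projective resolution. -/
noncomputable def homologyZeroIso (T : A ⥤ B) [T.Additive] [PreservesFiniteColimits T] {X : A}
    (R : ProjectiveResolution X) :
    ((T.mapHomologicalComplex _).obj R.complex).homology 0 ≅ T.obj X :=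
  ChainComplex.isoHomologyι₀ _ ≪≫ asIso (R.fromLeftDerivedZero' T)

lemma homologyZeroIso_naturality {T T' : A ⥤ B} [T.Additive] [T'.Additive]
    [PreservesFiniteColimits T] [PreservesFiniteColimits T'] (α : T ⟶ T') {X : A}
    (R : ProjectiveResolution X) :
    (homologyZeroIso T R).hom ≫ α.app X =
      HomologicalComplex.homologyMap ((NatTrans.mapHomologicalComplex α _).app R.complex) 0 ≫
        (homologyZeroIso T' R).hom := by
  have opcycles_naturality : R.fromLeftDerivedZero' T ≫ α.app X =
      HomologicalComplex.opcyclesMap ((NatTrans.mapHomologicalComplex α _).app R.complex) 0 ≫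
        R.fromLeftDerivedZero' T' := by
    rw [← cancel_epi (HomologicalComplex.pOpcycles _ _),
      R.pOpcycles_comp_fromLeftDerivedZero'_assoc, HomologicalComplex.p_opcyclesMap_assoc,
      R.pOpcycles_comp_fromLeftDerivedZero']
    exact α.naturality _
  simp [homologyZeroIso, opcycles_naturality]

/-- The short complex of chain complexes `S.X₁(P) → S.X₂(P) → S.X₃(P)` given by a short complex `S`
of additive functors and a chain complex `P`. -/
def mapChainComplex (S : ShortComplex (A ⥤ B)) [S.X₁.Additive] [S.X₂.Additive] [S.X₃.Additive]
    (P : ChainComplex A ℕ) : ShortComplex (ChainComplex B ℕ) :=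
  .mk ((NatTrans.mapHomologicalComplex S.f _).app P) ((NatTrans.mapHomologicalComplex S.g _).app P)
    (by ext n; exact NatTrans.congr_app S.zero (P.X n))

lemma shortExact_mapChainComplex {S : ShortComplex (A ⥤ B)} [S.X₁.Additive] [S.X₂.Additive]
    [S.X₃.Additive]
    (hS : ∀ P : A, Projective P → (S.map ((evaluation A B).obj P)).ShortExact)
    {P : ChainComplex A ℕ} (hP : ∀ n, Projective (P.X n)) : (mapChainComplex S P).ShortExact :=
  HomologicalComplex.shortExact_of_degreewise_shortExact _ fun n => hS (P.X n) (hP n)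

variable [EnoughProjectives A]

lemma isZero_leftDerived_succ_iff (T : A ⥤ B) [T.Additive] {X : A} (R : ProjectiveResolution X)
    (n : ℕ) :
    IsZero ((T.leftDerived (n + 1)).obj X) ↔
      ((ShortComplex.mk _ _ (R.complex.d_comp_d (n + 2) (n + 1) n)).map T).Exact := by
  rw [(R.isoLeftDerivedObj T (n + 1)).isZero_iff]
  exact (HomologicalComplex.exactAt_iff_isZero_homology _ _).symm.trans
    (HomologicalComplex.exactAt_iff' _ (n + 2) (n + 1) n (by simp) (by simp))

lemma isZero_leftDerived_shift_iff (T : A ⥤ B) [T.Additive] {S : ShortComplex A}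
    (hS : S.ShortExact) [Projective S.X₂] (n : ℕ) :
    IsZero ((T.leftDerived (n + 2)).obj S.X₃) ↔ IsZero ((T.leftDerived (n + 1)).obj S.X₁) := by
  rw [isZero_leftDerived_succ_iff T (projectiveResolution S.X₁),
    isZero_leftDerived_succ_iff T (splicedResolution hS (projectiveResolution S.X₁))]
  rfl

lemma isZero_leftDerived_one_iff (T : A ⥤ B) [T.Additive] [PreservesFiniteColimits T]
    {S : ShortComplex A} (hS : S.ShortExact) [Projective S.X₂] :
    IsZero ((T.leftDerived 1).obj S.X₃) ↔ Mono (T.map S.f) := by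
  let R := projectiveResolution S.X₁
  have : Epi (R.π.f 0) := inferInstance
  rw [isZero_leftDerived_succ_iff T (splicedResolution hS R)]
  exact exact_map_comp_iff_mono_map T R.exact₀ S.f _

section FunctorSequence

variable {S : ShortComplex (A ⥤ B)} [S.X₁.Additive] [S.X₂.Additive] [S.X₃.Additive]

theorem isZero_leftDerived_shift_iff_of_functor
    (hS : ∀ P : A, Projective P → (S.map ((evaluation A B).obj P)).ShortExact) (X : A)
    (h₂ : ∀ n, IsZero ((S.X₂.leftDerived (n + 1)).obj X)) (n : ℕ) :
    IsZero ((S.X₃.leftDerived (n + 2)).obj X) ↔ IsZero ((S.X₁.leftDerived (n + 1)).obj X) := by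
  let R := projectiveResolution X
  have hR := shortExact_mapChainComplex hS R.projective
  have hR₂ (n : ℕ) : IsZero ((mapChainComplex S R.complex).X₂.homology (n + 1)) :=
    (R.isoLeftDerivedObj S.X₂ (n + 1)).isZero_iff.1 (h₂ n)
  rw [(R.isoLeftDerivedObj S.X₃ (n + 2)).isZero_iff, (R.isoLeftDerivedObj S.X₁ (n + 1)).isZero_iff]
  exact (hR.δIso (n + 2) (n + 1) (by simp) (hR₂ _) (hR₂ _)).isZero_iff

theorem isZero_leftDerived_one_iff_of_functor [PreservesFiniteColimits S.X₁]
    [PreservesFiniteColimits S.X₂]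
    (hS : ∀ P : A, Projective P → (S.map ((evaluation A B).obj P)).ShortExact) (X : A)
    (h₂ : IsZero ((S.X₂.leftDerived 1).obj X)) :
    IsZero ((S.X₃.leftDerived 1).obj X) ↔ Mono (S.f.app X) := by
  let R := projectiveResolution X
  have hR := shortExact_mapChainComplex hS R.projective
  have hR₂ : IsZero ((mapChainComplex S R.complex).X₂.homology 1) :=
    (R.isoLeftDerivedObj S.X₂ 1).isZero_iff.1 h₂
  have rel : (ComplexShape.down ℕ).Rel 1 0 := by simp
  have mono_δ := hR.mono_δ 1 0 rel hR₂
  have mono_iff : IsZero ((mapChainComplex S R.complex).X₃.homology 1) ↔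
      Mono (HomologicalComplex.homologyMap (mapChainComplex S R.complex).f 0) := by
    refine ⟨fun h => (hR.homology_exact₁ 1 0 rel).mono_g (h.eq_of_src _ _), fun _ => ?_⟩
    refine IsZero.of_mono_eq_zero (hR.δ 1 0 rel) ?_
    rw [← cancel_mono (HomologicalComplex.homologyMap (mapChainComplex S R.complex).f 0),
      hR.δ_comp, zero_comp]
  rw [(R.isoLeftDerivedObj S.X₃ 1).isZero_iff]
  refine mono_iff.trans ((MorphismProperty.monomorphisms B).arrow_mk_iso_iff ?_)
  exact Arrow.isoMk (homologyZeroIso S.X₁ R) (homologyZeroIso S.X₂ R)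
    (homologyZeroIso_naturality S.f R)

end FunctorSequence

end DerivedFunctors

section AugmentedExact

lemma exact_iff_of_ladder {X Y Z X' Y' Z' : Type*} [Zero Z] [Zero Z'] {f : X → Y} {g : Y → Z}
    {f' : X' → Y'} {g' : Y' → Z'} {a : X → X'} {b : Y → Y'} {c : Z → Z'}
    (ha : Function.Surjective a) (hb : Function.Bijective b) (hc : Function.Injective c)
    (hc₀ : c 0 = 0) (h₁ : ∀ x, b (f x) = f' (a x)) (h₂ : ∀ y, c (g y) = g' (b y)) :
    Function.Exact f g ↔ Function.Exact f' g' := by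
  rw [Function.Exact, Function.Exact, hb.2.forall]
  refine forall_congr' fun y => iff_congr ?_ ⟨?_, ?_⟩
  · rw [← h₂, hc.eq_iff' hc₀]
  · rintro ⟨x, rfl⟩
    exact ⟨a x, (h₁ x).symm⟩
  · rintro ⟨x, hx⟩
    obtain ⟨x, rfl⟩ := ha x
    exact ⟨x, hb.1 ((h₁ x).trans hx)⟩

lemma exact_comp_iff_of_injective {X Y Z W : Type*} [Zero Z] [Zero W] {f : X → Y} {g : Y → Z}
    {c : Z → W} (hc : Function.Injective c) (hc₀ : c 0 = 0) :
    Function.Exact f (c ∘ g) ↔ Function.Exact f g := by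
  simp only [Function.Exact, Function.comp_apply, hc.eq_iff' hc₀]

lemma exact_comp_iff_of_surjective {W X Y Z : Type*} [Zero Z] {f : X → Y} {g : Y → Z} {a : W → X}
    (ha : Function.Surjective a) : Function.Exact (f ∘ a) g ↔ Function.Exact f g := by
  simp only [Function.Exact, ha.range_comp]

lemma bijective_iff_surjective_and_exact {A B C D : Type*} [AddGroup C] [AddGroup D] {p : A → B}
    {q : B → C} (h : Function.Exact p q) (hq : Function.Surjective q) (φ : C →+ D) :
    Function.Bijective φ ↔ Function.Surjective (φ ∘ q) ∧ Function.Exact p (φ ∘ q) := by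
  refine ⟨fun hφ => ⟨hφ.2.comp hq, (exact_comp_iff_of_injective hφ.1 (map_zero φ)).2 h⟩, ?_⟩
  rintro ⟨h₁, h₂⟩
  refine ⟨(injective_iff_map_eq_zero φ).2 fun c hc => ?_, .of_comp h₁⟩
  obtain ⟨b, rfl⟩ := hq c
  exact (h b).2 ((h₂ b).1 hc)

lemma natCast_succ_le_of_lt {i : ℕ} {k : ℕ∞} (hi : (i : ℕ∞) < k) : ((i + 1 : ℕ) : ℕ∞) ≤ k := by
  exact_mod_cast Order.add_one_le_of_lt hi

/-- Exactness of a sequence `A k → ⋯ → A 1 → A 0 → X → 0` of pointed sets, which is the infinite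
sequence `⋯ → A 1 → A 0 → X → 0` for `k = ⊤`. The maps not occurring in the sequence are
irrelevant. -/
def AugmentedExact (k : ℕ∞) {A : ℕ → Type*} {X : Type*} [∀ i, Zero (A i)] [Zero X]
    (d : ∀ i, A (i + 1) → A i) (ε : A 0 → X) : Prop :=
  Function.Surjective ε ∧ (0 < k → Function.Exact (d 0) ε) ∧
    ∀ i : ℕ, ((i + 1 : ℕ) : ℕ∞) < k → Function.Exact (d (i + 1)) (d i)

namespace AugmentedExact

variable {k : ℕ∞} {A : ℕ → Type*} {X : Type*} [∀ i, Zero (A i)] [Zero X]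
  {d : ∀ i, A (i + 1) → A i} {ε : A 0 → X}

lemma iff_of_ladder {A' : ℕ → Type*} {X' : Type*} [∀ i, Zero (A' i)] [Zero X']
    {d' : ∀ i, A' (i + 1) → A' i} {ε' : A' 0 → X'} (α : ∀ i, A i → A' i) {β : X → X'}
    (hα : ∀ i : ℕ, (i : ℕ∞) ≤ k → Function.Bijective (α i))
    (hα₀ : ∀ i : ℕ, (i : ℕ∞) ≤ k → α i 0 = 0)
    (hβ : Function.Bijective β) (hβ₀ : β 0 = 0)
    (hd : ∀ i : ℕ, ((i + 1 : ℕ) : ℕ∞) ≤ k → ∀ x, α i (d i x) = d' i (α (i + 1) x))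
    (hε : ∀ x, β (ε x) = ε' (α 0 x)) : AugmentedExact k d ε ↔ AugmentedExact k d' ε' := by
  have h_pred {i : ℕ} (hi : ((i + 1 : ℕ) : ℕ∞) ≤ k) : (i : ℕ∞) ≤ k := le_trans (by simp) hi
  have h₀ : ((0 : ℕ) : ℕ∞) ≤ k := by simp
  refine and_congr ?_ (and_congr (forall_congr' fun hk => ?_)
    (forall_congr' fun i => forall_congr' fun hi => ?_))
  · rw [← Function.Surjective.of_comp_iff' hβ ε, show β ∘ ε = ε' ∘ α 0 from funext hε,
      Function.Surjective.of_comp_iff _ (hα 0 h₀).surjective]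
  · have h₁ : ((1 : ℕ) : ℕ∞) ≤ k := natCast_succ_le_of_lt hk
    exact exact_iff_of_ladder (hα 1 h₁).2 (hα 0 h₀) hβ.1 hβ₀ (hd 0 h₁) hε
  · have hi' : ((i + 2 : ℕ) : ℕ∞) ≤ k := natCast_succ_le_of_lt hi
    exact exact_iff_of_ladder (hα (i + 2) hi').2 (hα (i + 1) hi.le)
      (hα i (h_pred hi.le)).1 (hα₀ i (h_pred hi.le)) (hd (i + 1) hi') (hd i hi.le)

lemma of_splice {Z : ℕ → Type*} [∀ i, Zero (Z i)] {ι : ∀ i, Z (i + 1) → A i} {π : ∀ i, A i → Z i}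
    (hι : ∀ i : ℕ, (i : ℕ∞) < k → Function.Injective (ι i))
    (hι₀ : ∀ i : ℕ, (i : ℕ∞) < k → ι i 0 = 0)
    (hπ : ∀ i : ℕ, (i : ℕ∞) ≤ k → Function.Surjective (π i))
    (h : ∀ i : ℕ, (i : ℕ∞) < k → Function.Exact (ι i) (π i)) :
    AugmentedExact k (fun i => ι i ∘ π (i + 1)) (π 0) := by
  refine ⟨hπ 0 (by simp), fun hk => ?_, fun i hi => ?_⟩
  · exact (exact_comp_iff_of_surjective (hπ 1 (natCast_succ_le_of_lt hk))).2 (h 0 hk)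
  · have hi' : (i : ℕ∞) < k := lt_of_le_of_lt (by simp) hi
    rw [exact_comp_iff_of_surjective (hπ (i + 2) (natCast_succ_le_of_lt hi)),
      exact_comp_iff_of_injective (hι i hi') (hι₀ i hi')]
    exact h (i + 1) hi

lemma comp_iff {A : ℕ → Type*} {C D : Type*} [∀ i, Zero (A i)] [AddGroup C] [AddGroup D]
    {d : ∀ i, A (i + 1) → A i} {q : A 0 → C} (hk : 1 ≤ k) (hq : Function.Surjective q)
    (h : Function.Exact (d 0) q) {Z : ℕ → Prop}
    (hZ : ∀ i : ℕ, ((i + 1 : ℕ) : ℕ∞) < k → (Z (i + 1) ↔ Function.Exact (d (i + 1)) (d i)))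
    (φ : C →+ D) : AugmentedExact k d (φ ∘ q) ↔
      Function.Bijective φ ∧ ∀ i : ℕ, 1 ≤ i → (i : ℕ∞) < k → Z i := by
  rw [AugmentedExact, forall_prop_of_true (Order.one_le_iff_pos.1 hk),
    bijective_iff_surjective_and_exact h hq φ, and_assoc]
  refine and_congr_right' (and_congr_right' ⟨fun h' i h₁ hi => ?_, fun h' i hi => ?_⟩)
  · obtain ⟨i, rfl⟩ := Nat.exists_eq_add_of_le' h₁
    exact (hZ i hi).2 (h' i hi)
  · exact (hZ i hi).1 (h' (i + 1) (Nat.le_add_left 1 i) hi)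

end AugmentedExact

end AugmentedExact

/-! ### Presentations by representable modules -/

section KernelOfRetraction

section Preadditive

variable {A : Type*} [Category* A] [Preadditive A] {Q R : A} {r : R ⟶ Q} {s : Q ⟶ R}

/-- The kernel of a retraction is complemented by the section. -/
noncomputable def kernelSplitting [HasKernel r]
    (hs : s ≫ r = 𝟙 Q) : (ShortComplex.mk (kernel.ι r) r (kernel.condition r)).Splitting where
  r := kernel.lift r (𝟙 R - r ≫ s) (by simp [Preadditive.sub_comp, hs])
  s := s
  f_r := by
    ext
    simp [Preadditive.comp_sub]
  s_g := hs
  id := by simp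

end Preadditive

variable {A : Type*} [Category* A] [Abelian A] {Q R : A} {r : R ⟶ Q} {s : Q ⟶ R}

lemma exact_desc_kernel_comp (hs : s ≫ r = 𝟙 Q) {P F : A} {f : P ⟶ Q} {g : Q ⟶ F} {w : f ≫ g = 0}
    (h : (ShortComplex.mk f g w).Exact) :
    ∃ w', (ShortComplex.mk (biprod.desc (f ≫ s) (kernel.ι r)) (r ≫ g) w').Exact := by
  refine ⟨by ext <;> simp [reassoc_of% hs, w], ?_⟩
  rw [ShortComplex.exact_iff_exact_up_to_refinements] at h ⊢
  intro T y hy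
  obtain ⟨T', p, hp, x, hx⟩ := h (y ≫ r) (by simpa using hy)
  dsimp at x hx hy
  refine ⟨T', p, hp, biprod.lift x (kernel.lift r (p ≫ y - x ≫ f ≫ s) ?_), ?_⟩
  · simp [hs, hx]
  · simp

lemma exact_comp_inl_desc_kernel (hs : s ≫ r = 𝟙 Q) {W P : A} {e : W ⟶ P} {f : P ⟶ Q}
    {w : e ≫ f = 0} (h : (ShortComplex.mk e f w).Exact) :
    ∃ w', (ShortComplex.mk (e ≫ biprod.inl) (biprod.desc (f ≫ s) (kernel.ι r)) w').Exact := by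
  refine ⟨by simp [reassoc_of% w], ?_⟩
  rw [ShortComplex.exact_iff_exact_up_to_refinements] at h ⊢
  intro T y hy
  dsimp at y hy
  have hf : y ≫ biprod.fst ≫ f = 0 := by
    simpa [biprod.desc_eq, hs] using congrArg (· ≫ r) hy
  have hι : y ≫ biprod.snd = 0 := by
    rw [← cancel_mono (kernel.ι r)]
    simpa [biprod.desc_eq, reassoc_of% hf] using hy
  obtain ⟨T', p, hp, x, hx⟩ := h (y ≫ biprod.fst) (by simpa using hf)
  refine ⟨T', p, hp, x, ?_⟩
  ext
  · simpa using hx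
  · simp [hι]

end KernelOfRetraction

section Modules

variable {C : Type u} [Category.{v} C] [Preadditive C]

namespace LeftMod

lemma map_hom_apply {F G : LeftMod.{v, u} C} (p : F ⟶ G) {c d : C} (f : c ⟶ d)
    (x : F.obj.obj c) : p.hom.app d (F.obj.map f x) = G.obj.map f (p.hom.app c x) :=
  ConcreteCategory.congr_hom (p.hom.naturality f) x

lemma map_comp_apply (F : LeftMod.{v, u} C) {b c d : C} (f : b ⟶ c) (g : c ⟶ d)
    (x : F.obj.obj b) : F.obj.map (f ≫ g) x = F.obj.map g (F.obj.map f x) := by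
  simp

lemma hom_ext_apply {F G : LeftMod.{v, u} C} {p q : F ⟶ G}
    (h : ∀ c (x : F.obj.obj c), p.hom.app c x = q.hom.app c x) : p = q := by
  ext c x
  exact h c x

lemma congr_app_apply {F G : LeftMod.{v, u} C} {p q : F ⟶ G} (h : p = q) {c : C}
    (x : F.obj.obj c) : p.hom.app c x = q.hom.app c x := by
  rw [h]

lemma ofElement_comp {F G : LeftMod.{v, u} C} (p : F ⟶ G) {c : C} (x : F.obj.obj c) :
    ofElement F c x ≫ p = ofElement G c (p.hom.app c x) :=
  hom_ext_apply fun _ _ => map_hom_apply p _ x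

lemma eq_ofElement {F : LeftMod.{v, u} C} {c : C} (p : homFrom (𝟭 C) c ⟶ F) :
    p = ofElement F c (p.hom.app c ⟨𝟙 c⟩) :=
  hom_ext_apply fun d g =>
    (congrArg (p.hom.app d) (ULift.ext _ _ (Category.id_comp _).symm)).trans
      (map_hom_apply p (F := homFrom (𝟭 C) c) (ULift.down g) ⟨𝟙 c⟩)

lemma ofElement_injective {F : LeftMod.{v, u} C} {c : C} :
    Function.Injective (ofElement F c) := fun x y h => by
  have : F.obj.map (𝟙 c) x = F.obj.map (𝟙 c) y := congr_app_apply h ⟨𝟙 c⟩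
  simpa using this

lemma ofElement_zero (F : LeftMod.{v, u} C) (c : C) : ofElement F c 0 = 0 :=
  hom_ext_apply fun _ g => map_zero (F.obj.map (ULift.down g)).hom

lemma epi_ofElement_iff {F : LeftMod.{v, u} C} {c : C} {x : F.obj.obj c} :
    Epi (ofElement F c x) ↔ ∀ d, Function.Surjective (fun f : c ⟶ d => F.obj.map f x) :=
  (leftMod_epi_iff _).trans <| forall_congr' fun d =>
    (Function.Surjective.of_comp_iff ((ofElement F c x).hom.app d) ULift.up_surjective).symm

lemma mono_iff {F G : LeftMod.{v, u} C} (p : F ⟶ G) :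
    Mono p ↔ ∀ c, Function.Injective (p.hom.app c) := by
  refine ⟨fun _ c x y h => ?_, fun h => ⟨fun f g w => hom_ext_apply fun c x => h c ?_⟩⟩
  · apply ofElement_injective
    rw [← cancel_mono p, ofElement_comp, ofElement_comp, h]
  · exact congr_app_apply w x

lemma exact_iff {F G H : LeftMod.{v, u} C} (f : F ⟶ G) (g : G ⟶ H) :
    (∃ w : f ≫ g = 0, (ShortComplex.mk f g w).Exact) ↔
      ∀ c, Function.Exact (f.hom.app c) (g.hom.app c) := by
  constructor
  · rintro ⟨w, h⟩ c y
    refine ⟨fun hy => ?_, ?_⟩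
    · have hy' : ofElement G c y ≫ g = 0 := by rw [ofElement_comp, hy, ofElement_zero]
      refine ⟨(h.liftFromProjective (ofElement G c y) hy').hom.app c ⟨𝟙 c⟩, ?_⟩
      apply ofElement_injective
      rw [← ofElement_comp, ← eq_ofElement]
      exact h.liftFromProjective_comp (ofElement G c y) hy'
    · rintro ⟨x, rfl⟩
      exact congr_app_apply w x
  · intro h
    have w : f ≫ g = 0 := hom_ext_apply fun c x => (h c _).2 ⟨x, rfl⟩
    refine ⟨w, ?_⟩
    rw [ShortComplex.exact_iff_epi_kernel_lift, leftMod_epi_iff]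
    intro c y
    obtain ⟨x, hx⟩ := (h c _).1 (congr_app_apply (kernel.condition g) y)
    exact ⟨x, (mono_iff (kernel.ι g)).1 inferInstance c
      ((congr_app_apply (kernel.lift_ι g f w) x).trans hx)⟩

lemma biprod_total_apply {F G : LeftMod.{v, u} C} {c : C} (y : (F ⊞ G).obj.obj c) :
    (biprod.inl : F ⟶ F ⊞ G).hom.app c ((biprod.fst : F ⊞ G ⟶ F).hom.app c y) +
      (biprod.inr : G ⟶ F ⊞ G).hom.app c ((biprod.snd : F ⊞ G ⟶ G).hom.app c y) = y :=
  congr_app_apply (biprod.total : biprod.fst ≫ biprod.inl + biprod.snd ≫ biprod.inr = 𝟙 (F ⊞ G)) y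

section Presentations

lemma homFrom_fg (c : C) : (homFrom (𝟭 C) c : LeftMod.{v, u} C).FG :=
  ⟨1, fun _ => c, fun _ => ⟨𝟙 c⟩, fun d y => ⟨fun _ => ULift.down y, by
    rw [Fin.sum_univ_one]
    exact ULift.ext _ _ (Category.id_comp _).symm⟩⟩

lemma FG.of_epi {F G : LeftMod.{v, u} C} (h : F.FG) (p : F ⟶ G) [hp : Epi p] : G.FG := by
  obtain ⟨n, c, x, hx⟩ := h
  refine ⟨n, c, fun i => p.hom.app _ (x i), fun d y => ?_⟩
  obtain ⟨z, rfl⟩ := (leftMod_epi_iff p).1 hp d y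
  obtain ⟨f, rfl⟩ := hx d z
  exact ⟨f, by simp⟩

lemma isPresented_iff {k : ℕ∞} {F : LeftMod.{v, u} C} : F.IsPresented k ↔
    ∃ (Q : ℕ → LeftMod.{v, u} C) (d : ∀ i, Q (i + 1) ⟶ Q i) (ε : Q 0 ⟶ F),
      (∀ i : ℕ, (i : ℕ∞) ≤ k → Projective (Q i) ∧ (Q i).FG) ∧
      ∀ c, AugmentedExact k (A := fun i => (Q i).obj.obj c) (fun i x => (d i).hom.app c x)
        (fun x => ε.hom.app c x) := by
  refine exists_congr fun Q => exists_congr fun d => exists_congr fun ε => and_congr_right' ?_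
  simp only [AugmentedExact, leftMod_epi_iff, exact_iff, forall_and]
  exact and_congr_right' (and_congr forall_comm
    ⟨fun h c i hi => h i hi c, fun h i hi c => h c i hi⟩)

variable [HasFiniteBiproducts C]

lemma FG.exists_epi {F : LeftMod.{v, u} C} (h : F.FG) :
    ∃ (c : C) (x : F.obj.obj c), Epi (ofElement F c x) := by
  obtain ⟨n, c, x, hx⟩ := h
  refine ⟨⨁ c, ∑ i, F.obj.map (biproduct.ι c i) (x i), epi_ofElement_iff.2 fun d y => ?_⟩
  obtain ⟨f, rfl⟩ := hx d y
  refine ⟨biproduct.desc f, ?_⟩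
  simp [← map_comp_apply]

lemma FG.biprod {F G : LeftMod.{v, u} C} (hF : F.FG) (hG : G.FG) :
    LeftMod.FG (F ⊞ G : LeftMod.{v, u} C) := by
  have := hasBinaryBiproducts_of_finite_biproducts C
  obtain ⟨c, x, hx⟩ := hF.exists_epi
  obtain ⟨c', x', hx'⟩ := hG.exists_epi
  rw [epi_ofElement_iff] at hx hx'
  let z := (biprod.inl : F ⟶ F ⊞ G).hom.app _ (F.obj.map biprod.inl x) +
    (biprod.inr : G ⟶ F ⊞ G).hom.app _ (G.obj.map biprod.inr x')
  have : Epi (ofElement (F ⊞ G) (c ⊞ c') z) := by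
    rw [epi_ofElement_iff]
    intro d y
    obtain ⟨f, hf⟩ := hx d ((biprod.fst : F ⊞ G ⟶ F).hom.app d y)
    obtain ⟨g, hg⟩ := hx' d ((biprod.snd : F ⊞ G ⟶ G).hom.app d y)
    refine ⟨biprod.desc f g, Eq.trans ?_ (biprod_total_apply y)⟩
    simp only [z, map_add, ← map_hom_apply, ← map_comp_apply, biprod.inl_desc, biprod.inr_desc]
    exact congrArg₂ (· + ·) (congrArg _ hf) (congrArg _ hg)
  exact (homFrom_fg (c ⊞ c')).of_epi (ofElement (F ⊞ G) _ z)

lemma isPresented_kernel_comp {k : ℕ∞} {F R : LeftMod.{v, u} C} {Q : ℕ → LeftMod.{v, u} C}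
    {d : ∀ i, Q (i + 1) ⟶ Q i} {ε : Q 0 ⟶ F}
    (hQ : ∀ i : ℕ, (i : ℕ∞) ≤ k → Projective (Q (i + 1)) ∧ (Q (i + 1)).FG)
    (h₀ : ∃ w : d 0 ≫ ε = 0, (ShortComplex.mk (d 0) ε w).Exact)
    (h : ∀ i : ℕ, (i : ℕ∞) < k →
      ∃ w : d (i + 1) ≫ d i = 0, (ShortComplex.mk (d (i + 1)) (d i) w).Exact)
    [Projective R] (hR : R.FG) {r : R ⟶ Q 0} {s : Q 0 ⟶ R} (hs : s ≫ r = 𝟙 (Q 0)) :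
    IsPresented k (kernel (r ≫ ε)) := by
  have hr : Retract (kernel r) _ :=
    ⟨kernel.ι r, (kernelSplitting hs).r, (kernelSplitting hs).f_r⟩
  have : IsSplitEpi hr.r := .mk' hr.splitEpi
  have : Projective (kernel r) := hr.projective
  obtain ⟨w₀, hw₀⟩ := exact_desc_kernel_comp hs h₀.choose_spec
  refine ⟨fun i => Nat.casesOn i (Q 1 ⊞ kernel r) fun i => Q (i + 2),
    fun i => Nat.casesOn i (d 1 ≫ biprod.inl) fun i => d (i + 2), kernel.lift _ _ w₀, ?_,
    (ShortComplex.exact_iff_epi_kernel_lift _).1 hw₀, fun hk => ?_, ?_⟩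
  · rintro (_ | i) hi
    · have := (hQ 0 hi).1
      exact ⟨inferInstanceAs (Projective (Q 1 ⊞ kernel r)), (hQ 0 hi).2.biprod (hR.of_epi hr.r)⟩
    · exact hQ (i + 1) hi
  · obtain ⟨w₁, hw₁⟩ := exact_comp_inl_desc_kernel hs (h 0 hk).choose_spec
    have w : (d 1 ≫ biprod.inl) ≫ kernel.lift (r ≫ ε) _ w₀ = 0 := by
      rw [← cancel_mono (kernel.ι _), Category.assoc, kernel.lift_ι, w₁, zero_comp]
    exact ⟨w, (exact_comp_mono_iff (kernel.ι _) w (comp_comp_eq_zero w _)).1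
      (by simpa only [kernel.lift_ι] using hw₁)⟩
  · rintro (_ | i) hi
    · obtain ⟨w, hw⟩ := h 1 hi
      exact ⟨_, (exact_comp_mono_iff biprod.inl w (comp_comp_eq_zero w _)).2 hw⟩
    · exact h (i + 2) hi

lemma IsPresented.exists_kernel_ofElement {k : ℕ∞} {F : LeftMod.{v, u} C}
    (h : F.IsPresented (k + 1)) :
    ∃ (c : C) (x : F.obj.obj c), Epi (ofElement F c x) ∧
      IsPresented k (kernel (ofElement F c x)) := by
  obtain ⟨Q, d, ε, hQ, hε, h₀, hd⟩ := h
  have hQ₀ := hQ 0 (by simp)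
  have := hQ₀.1
  obtain ⟨c, x, hx⟩ := hQ₀.2.exists_epi
  refine ⟨c, ε.hom.app c x, ofElement_comp ε x ▸ epi_comp _ _, ?_⟩
  rw [← ofElement_comp]
  refine isPresented_kernel_comp (fun i hi => hQ (i + 1) (by push_cast; gcongr))
    (h₀ (by simp)) (fun i hi => hd i ?_) (homFrom_fg c)
    (Projective.factorThru_comp (𝟙 (Q 0)) (ofElement (Q 0) c x))
  push_cast
  exact (ENat.add_lt_add_iff_right (by simp)).2 hi

lemma IsPresented.exists_syzygy {k : ℕ∞} {F : LeftMod.{v, u} C} (h : F.IsPresented k) :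
    ∃ (c : C) (x : F.obj.obj c) (G : LeftMod.{v, u} C) (κ : G ⟶ homFrom (𝟭 C) c),
      G.IsPresented (k - 1) ∧ Epi (ofElement F c x) ∧
      (0 < k → Mono κ ∧ ∃ w, (ShortComplex.mk κ (ofElement F c x) w).Exact) := by
  obtain rfl | hk := eq_or_ne k 0
  · have ⟨Q, _, ε, hQ, _, _⟩ := h
    obtain ⟨c, x, hx⟩ := ((hQ 0 le_rfl).2.of_epi ε).exists_epi
    exact ⟨c, x, F, 0, by simpa using h, hx, by simp⟩
  · obtain ⟨c, x, hx, hK⟩ := IsPresented.exists_kernel_ofElement (k := k - 1)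
      (by rwa [tsub_add_cancel_of_le (Order.one_le_iff_pos.2 (pos_iff_ne_zero.2 hk))])
    exact ⟨c, x, _, kernel.ι _, hK, hx,
      fun _ => ⟨inferInstance, kernel.condition _, ShortComplex.exact_kernel _⟩⟩

lemma IsPresented.exists_syzygies {k : ℕ∞} {F : LeftMod.{v, u} C} (h : F.IsPresented k) :
    ∃ (Z : ℕ → LeftMod.{v, u} C) (c : ℕ → C) (x : ∀ i, (Z i).obj.obj (c i))
      (κ : ∀ i, Z (i + 1) ⟶ homFrom (𝟭 C) (c i)), Z 0 = F ∧ ∀ i : ℕ,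
        Epi (ofElement (Z i) (c i) (x i)) ∧ ((i : ℕ∞) < k →
          Mono (κ i) ∧ ∃ w, (ShortComplex.mk (κ i) (ofElement (Z i) (c i) (x i)) w).Exact) := by
  choose c x G κ hG hx hκ using
    fun (i : ℕ) (Z : {Z : LeftMod.{v, u} C // Z.IsPresented (k - i)}) => Z.2.exists_syzygy
  let Z (i : ℕ) : {Z : LeftMod.{v, u} C // Z.IsPresented (k - i)} :=
    Nat.rec ⟨F, by simpa using h⟩ (fun i Z => ⟨G i Z, by simpa [tsub_tsub] using hG i Z⟩) i
  exact ⟨fun i => (Z i).1, fun i => c i (Z i), fun i => x i (Z i), fun i => κ i (Z i), rfl,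
    fun i => ⟨hx i (Z i), fun hi => hκ i (Z i) (tsub_pos_of_lt hi)⟩⟩

end Presentations

/-- The module `F` has the `k`-presentation `⋯ → Hom(c 1, -) → Hom(c 0, -) → F → 0` by
representable modules, with maps given by `δ i : c i ⟶ c (i + 1)` and the element `x` of
`F (c 0)`. -/
def IsRepresentablePresentation (k : ℕ∞) (F : LeftMod.{v, u} C) (c : ℕ → C)
    (δ : ∀ i, c i ⟶ c (i + 1)) (x : F.obj.obj (c 0)) : Prop :=
  ∀ d, AugmentedExact k (fun i (f : c (i + 1) ⟶ d) => δ i ≫ f) (fun f : c 0 ⟶ d => F.obj.map f x)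

lemma isRepresentablePresentation_iff {k : ℕ∞} {F : LeftMod.{v, u} C} {c : ℕ → C}
    {δ : ∀ i, c i ⟶ c (i + 1)} {x : F.obj.obj (c 0)} :
    F.IsRepresentablePresentation k c δ x ↔
      ∀ d, AugmentedExact k (A := fun i => (homFrom (𝟭 C) (c i)).obj.obj d)
        (fun i f => (ofElement (homFrom (𝟭 C) (c i)) (c (i + 1)) ⟨δ i⟩).hom.app d f)
        (fun f => (ofElement F (c 0) x).hom.app d f) :=
  forall_congr' fun _ => AugmentedExact.iff_of_ladder (fun _ => ULift.up) (β := id)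
    (fun _ _ => Equiv.ulift.symm.bijective) (fun _ _ => rfl) Function.bijective_id rfl
    (fun _ _ _ => rfl) (fun _ => rfl)

lemma IsRepresentablePresentation.isPresented {k : ℕ∞} {F : LeftMod.{v, u} C} {c : ℕ → C}
    {δ : ∀ i, c i ⟶ c (i + 1)} {x : F.obj.obj (c 0)}
    (h : F.IsRepresentablePresentation k c δ x) : F.IsPresented k :=
  isPresented_iff.2 ⟨_, _, _, fun i _ => ⟨inferInstance, homFrom_fg (c i)⟩,
    isRepresentablePresentation_iff.1 h⟩

theorem IsPresented.exists_isRepresentablePresentation [HasFiniteBiproducts C] {k : ℕ∞}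
    {F : LeftMod.{v, u} C} (h : F.IsPresented k) :
    ∃ (c : ℕ → C) (δ : ∀ i, c i ⟶ c (i + 1)) (x : F.obj.obj (c 0)),
      F.IsRepresentablePresentation k c δ x := by
  obtain ⟨Z, c, x, κ, rfl, hZ⟩ := h.exists_syzygies
  refine ⟨c, fun i => ((κ i).hom.app _ (x (i + 1))).down, x 0, fun d => ?_⟩
  have hκ (i : ℕ) (f : c (i + 1) ⟶ d) :
      ((κ i).hom.app d ((Z (i + 1)).obj.map f (x (i + 1)))).down =
        ((κ i).hom.app _ (x (i + 1))).down ≫ f :=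
    congrArg ULift.down (map_hom_apply (κ i) f (x (i + 1)))
  simp only [← hκ]
  refine AugmentedExact.of_splice (Z := fun i => (Z i).obj.obj d)
    (ι := fun i z => ((κ i).hom.app d z).down) (π := fun i f => (Z i).obj.map f (x i))
    (fun i hi => ULift.down_injective.comp ((mono_iff _).1 ((hZ i).2 hi).1 d))
    (fun i _ => congrArg ULift.down (map_zero ((κ i).hom.app d).hom))
    (fun i _ => epi_ofElement_iff.1 (hZ i).1 d) (fun i hi => ?_)
  exact (exact_iff_of_ladder (f := (κ i).hom.app d) (g := (ofElement _ _ (x i)).hom.app d)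
    (b := ULift.down) (c := id) Function.surjective_id Equiv.ulift.bijective Function.injective_id
    rfl (fun _ => rfl) (fun _ => rfl)).1 ((exact_iff _ _).1 ((hZ i).2 hi).2 d)

end LeftMod

end Modules

/-! ### The tensor product with a presented module -/

section Tensor

open Opposite

variable {C : Type u} [Category.{v} C] [Preadditive C]

/-- The tensor product as a functor in both variables, with the left module as the first one. -/
def tensorFunctor : LeftMod.{v, u} C ⥤ RightMod.{v, u} C ⥤ AddCommGrpCat.{max u v} where
  obj := tensorRight
  map β :=
    { app := fun F => AddCommGrpCat.ofHom (tensorLift (fun c x y => tmul x (β.hom.app c y))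
        (fun _ _ _ _ => tmul_add_left _ _ _)
        (fun _ _ _ _ => by simp [tmul_add_right])
        (fun _ _ f _ _ => by rw [tmul_balanced, LeftMod.map_hom_apply]))
      naturality := fun F F' α => by
        ext : 1
        exact tensor_hom_ext fun c x y => rfl }
  map_id G := by
    ext F : 3
    exact tensor_hom_ext fun c x y => rfl
  map_comp β γ := by
    ext F : 3
    exact tensor_hom_ext fun c x y => rfl

/-- The biadditive map `(x, y) ↦ x ⊗ y`. -/
def tmulHom (F : RightMod.{v, u} C) (G : LeftMod.{v, u} C) (c : C) :
    F.obj.obj (op c) →+ G.obj.obj c →+ TensorObj F G :=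
  AddMonoidHom.mk' (fun x => AddMonoidHom.mk' (tmul x) (tmul_add_right x))
    fun x₁ x₂ => AddMonoidHom.ext fun y => tmul_add_left x₁ x₂ y

/-- The right adjoint `A ↦ Hom(G(-), A)` of `- ⊗ G`. -/
def leftModDual (G : LeftMod.{v, u} C) : AddCommGrpCat.{max u v} ⥤ RightMod.{v, u} C where
  obj A := ⟨G.obj.op ⋙ preadditiveYoneda.obj A, inferInstanceAs (Functor.Additive _)⟩
  map a := ObjectProperty.homMk (Functor.whiskerLeft _ (preadditiveYoneda.map a))

/-- The right adjoint `A ↦ Hom(F(-), A)` of `F ⊗ -`. -/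
def rightModDual (F : RightMod.{v, u} C) : AddCommGrpCat.{max u v} ⥤ LeftMod.{v, u} C where
  obj A := ⟨F.obj.rightOp ⋙ preadditiveYoneda.obj A, inferInstanceAs (Functor.Additive _)⟩
  map a := ObjectProperty.homMk (Functor.whiskerLeft _ (preadditiveYoneda.map a))

section Adjunction

variable {F : RightMod.{v, u} C} {G : LeftMod.{v, u} C} {A : AddCommGrpCat.{max u v}}

/-- A homomorphism `F ⊗ G → A` as a natural family of homomorphisms `F c → Hom(G c, A)`. -/
def tensorCurryRight (φ : TensorObj F G →+ A) : F ⟶ (leftModDual G).obj A :=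
  ObjectProperty.homMk
    { app c := AddCommGrpCat.ofHom
        (AddCommGrpCat.homAddEquiv.symm.toAddMonoidHom.comp (φ.compHom.comp (tmulHom F G c.unop)))
      naturality c d f := by
        ext x
        exact AddCommGrpCat.hom_ext
          (AddMonoidHom.ext fun y => congrArg φ (tmul_balanced f.unop x y)) }

/-- The component at `c` of a natural family `F c → Hom(G c, A)`, as a biadditive map. -/
def biadditiveOfRight (α : F ⟶ (leftModDual G).obj A) (c : C) :
    F.obj.obj (op c) →+ G.obj.obj c →+ A :=
  AddCommGrpCat.homAddEquiv.toAddMonoidHom.comp (α.hom.app (op c)).hom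

/-- The homomorphism `F ⊗ G → A` given by a natural family `F c → Hom(G c, A)`. -/
def tensorUncurryRight (α : F ⟶ (leftModDual G).obj A) : TensorObj F G →+ A :=
  tensorLift (fun c x y => biadditiveOfRight α c x y)
    (fun c x x' y => by rw [map_add, AddMonoidHom.add_apply])
    (fun c x => map_add (biadditiveOfRight α c x)) (fun c d f x => DFunLike.congr_fun (congrArg
      AddCommGrpCat.homAddEquiv (LeftMod.map_hom_apply α f.op x)))

lemma tensorUncurryRight_tmul (α : F ⟶ (leftModDual G).obj A) {c : C}
    (x : F.obj.obj (op c)) (y : G.obj.obj c) :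
    tensorUncurryRight α (tmul x y) = biadditiveOfRight α c x y :=
  tensorLift_tmul _ _ _ _ _ _

/-- The functor `A ↦ Hom(G(-), A)` is right adjoint to `- ⊗ G`. -/
def tensorRightAdjunction (G : LeftMod.{v, u} C) : tensorRight G ⊣ leftModDual G :=
  Adjunction.mkOfHomEquiv
    { homEquiv _ _ :=
        { toFun φ := tensorCurryRight φ.hom
          invFun α := AddCommGrpCat.ofHom (tensorUncurryRight α)
          left_inv _ := AddCommGrpCat.hom_ext <| tensor_hom_ext fun _ _ _ =>
            tensorUncurryRight_tmul _ _ _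
          right_inv α := LeftMod.hom_ext_apply fun _ x => AddCommGrpCat.hom_ext <|
            AddMonoidHom.ext fun y => tensorUncurryRight_tmul α x y }
      homEquiv_naturality_left_symm α β := AddCommGrpCat.hom_ext <| tensor_hom_ext fun _ x y =>
        (tensorUncurryRight_tmul (α ≫ β) x y).trans
          (tensorUncurryRight_tmul β (α.hom.app _ x) y).symm
      homEquiv_naturality_right _ _ := rfl }

/-- A homomorphism `F ⊗ G → A` as a natural family of homomorphisms `G c → Hom(F c, A)`. -/
def tensorCurryLeft (φ : TensorObj F G →+ A) : G ⟶ (rightModDual F).obj A :=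
  ObjectProperty.homMk
    { app c := AddCommGrpCat.ofHom
        (AddCommGrpCat.homAddEquiv.symm.toAddMonoidHom.comp (φ.compHom.comp (tmulHom F G c).flip))
      naturality c d f := by
        ext y
        exact AddCommGrpCat.hom_ext
          (AddMonoidHom.ext fun x => congrArg φ (tmul_balanced f x y).symm) }

/-- The component at `c` of a natural family `G c → Hom(F c, A)`, as a biadditive map. -/
def biadditiveOfLeft (α : G ⟶ (rightModDual F).obj A) (c : C) :
    G.obj.obj c →+ F.obj.obj (op c) →+ A :=
  AddCommGrpCat.homAddEquiv.toAddMonoidHom.comp (α.hom.app c).hom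

/-- The homomorphism `F ⊗ G → A` given by a natural family `G c → Hom(F c, A)`. -/
def tensorUncurryLeft (α : G ⟶ (rightModDual F).obj A) : TensorObj F G →+ A :=
  tensorLift (fun c x y => biadditiveOfLeft α c y x)
    (fun c x x' y => map_add (biadditiveOfLeft α c y) x x')
    (fun c x y y' => by rw [map_add, AddMonoidHom.add_apply]) (fun c d f x y =>
      DFunLike.congr_fun (congrArg AddCommGrpCat.homAddEquiv (LeftMod.map_hom_apply α f y)).symm x)

lemma tensorUncurryLeft_tmul (α : G ⟶ (rightModDual F).obj A) {c : C}
    (x : F.obj.obj (op c)) (y : G.obj.obj c) :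
    tensorUncurryLeft α (tmul x y) = biadditiveOfLeft α c y x :=
  tensorLift_tmul _ _ _ _ _ _

/-- The functor `A ↦ Hom(F(-), A)` is right adjoint to `F ⊗ -`. -/
def tensorLeftAdjunction (F : RightMod.{v, u} C) :
    (tensorFunctor.flip.obj F : LeftMod.{v, u} C ⥤ _) ⊣ rightModDual F :=
  Adjunction.mkOfHomEquiv
    { homEquiv _ _ :=
        { toFun φ := tensorCurryLeft φ.hom
          invFun α := AddCommGrpCat.ofHom (tensorUncurryLeft α)
          left_inv _ := AddCommGrpCat.hom_ext <| tensor_hom_ext fun _ _ _ =>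
            tensorUncurryLeft_tmul _ _ _
          right_inv α := LeftMod.hom_ext_apply fun _ y => AddCommGrpCat.hom_ext <|
            AddMonoidHom.ext fun x => tensorUncurryLeft_tmul α x y }
      homEquiv_naturality_left_symm α β := AddCommGrpCat.hom_ext <| tensor_hom_ext fun _ x y =>
        (tensorUncurryLeft_tmul (α ≫ β) x y).trans
          (tensorUncurryLeft_tmul β x (α.hom.app _ y)).symm
      homEquiv_naturality_right _ _ := rfl }

instance (G : LeftMod.{v, u} C) : PreservesFiniteColimits (tensorRight G) :=
  have := (tensorRightAdjunction G).leftAdjoint_preservesColimits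
  inferInstance

instance (F : RightMod.{v, u} C) :
    PreservesFiniteColimits (tensorFunctor.flip.obj F : LeftMod.{v, u} C ⥤ _) :=
  have := (tensorLeftAdjunction F).leftAdjoint_preservesColimits
  inferInstance

instance (F : RightMod.{v, u} C) :
    (tensorFunctor.flip.obj F : LeftMod.{v, u} C ⥤ AddCommGrpCat.{max u v}).Additive where
  map_add := AddCommGrpCat.hom_ext <| tensor_hom_ext fun _ _ _ => tmul_add_right _ _ _

end Adjunction

section Flat

instance : (tensorFunctor : LeftMod.{v, u} C ⥤ RightMod.{v, u} C ⥤ _).Additive where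
  map_add := NatTrans.ext <| funext fun _ =>
    AddCommGrpCat.hom_ext <| tensor_hom_ext fun _ _ _ => tmul_add_right _ _ _

instance mono_tensorFunctor_map_app {G G' : LeftMod.{v, u} C} (β : G ⟶ G') [Mono β]
    (P : RightMod.{v, u} C) [Projective P] : Mono ((tensorFunctor.map β).app P) := by
  have hβ (c : C) : Mono (β.hom.app c) :=
    (AddCommGrpCat.mono_iff_injective _).2 ((LeftMod.mono_iff β).1 inferInstance c)
  let A := (tensorFunctor.obj G).obj P
  let J := Injective.under A
  let restrict : (leftModDual G').obj J ⟶ (leftModDual G).obj J :=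
    ObjectProperty.homMk (Functor.whiskerRight (NatTrans.op β.hom) _)
  have : Epi restrict := (leftMod_epi_iff _).2 fun c f =>
    ⟨Injective.factorThru f (β.hom.app c.unop), Injective.comp_factorThru f (β.hom.app c.unop)⟩
  let extension : P ⟶ (leftModDual G').obj J :=
    Projective.factorThru (tensorCurryRight (Injective.ι A).hom) restrict
  have h_ext : (tensorFunctor.map β).app P ≫ AddCommGrpCat.ofHom (tensorUncurryRight extension) =
      Injective.ι A := by
    refine AddCommGrpCat.hom_ext <| tensor_hom_ext fun c x y => ?_
    refine (tensorUncurryRight_tmul extension x (β.hom.app c y)).trans ?_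
    exact congrArg (AddCommGrpCat.homAddEquiv · y) (LeftMod.congr_app_apply
      (Projective.factorThru_comp (tensorCurryRight (Injective.ι A).hom) restrict) x)
  exact mono_of_mono_fac h_ext

lemma shortExact_map_tensorFunctor {S : ShortComplex (LeftMod.{v, u} C)} (hS : S.ShortExact)
    (P : RightMod.{v, u} C) [Projective P] : (S.map (tensorFunctor.flip.obj P)).ShortExact := by
  have := hS.mono_f
  have := hS.epi_g
  have : Mono (S.map (tensorFunctor.flip.obj P)).f := mono_tensorFunctor_map_app S.f P
  have : Epi (S.map (tensorFunctor.flip.obj P)).g :=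
    inferInstanceAs (Epi ((tensorFunctor.flip.obj P).map S.g))
  exact ⟨hS.exact.map_of_epi_of_preservesCokernel _ hS.epi_g inferInstance⟩

end Flat

section CoYoneda

variable (F : RightMod.{v, u} C) (G : LeftMod.{v, u} C)

/-- The evaluation map `F ⊗ Hom(c, -) → F c`. -/
def tensorHomFromEval (c : C) : TensorObj F (homFrom (𝟭 C) c) →+ F.obj.obj (op c) :=
  tensorLift (F := F) (G := homFrom (𝟭 C) c)
    (fun _ x f => F.obj.map (Quiver.Hom.op (ULift.down f)) x) (fun _ _ _ _ => map_add _ _ _)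
    (fun d x f g =>
      map_add ((ofElement F (op d) x).hom.app (op c)).hom ⟨f.down.op⟩ ⟨g.down.op⟩)
    (fun _ _ f x g => (LeftMod.map_comp_apply F f.op (Quiver.Hom.op (ULift.down g)) x).symm)

lemma tmul_id_bijective (c : C) : Function.Bijective
    (fun x : F.obj.obj (op c) => (tmul (G := homFrom (𝟭 C) c) x ⟨𝟙 c⟩)) := by
  refine Function.bijective_iff_has_inverse.2 ⟨tensorHomFromEval F c, fun x => ?_, ?_⟩
  · refine (tensorLift_tmul (G := homFrom (𝟭 C) c) _ _ _ _ x ⟨𝟙 c⟩).trans ?_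
    exact ConcreteCategory.congr_hom (F.obj.map_id (op c)) x
  · refine DFunLike.congr_fun (f := ((tmulHom F (homFrom (𝟭 C) c) c).flip ⟨𝟙 c⟩).comp
      (tensorHomFromEval F c)) (g := AddMonoidHom.id _) (tensor_hom_ext fun d x f => ?_)
    refine (congrArg (tmul · _) (tensorLift_tmul (G := homFrom (𝟭 C) c) _ _ _ _ x f)).trans ?_
    refine (tmul_balanced (G := homFrom (𝟭 C) c) (ULift.down f) x ⟨𝟙 c⟩).trans ?_
    exact congrArg (tmul x) (ULift.ext _ _ (Category.id_comp _))

/-- The evaluation map `Hom(-, c) ⊗ G → G c`. -/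
def homToTensorEval (c : Cᵒᵖ) : TensorObj (homFrom (𝟭 Cᵒᵖ) c) G →+ G.obj.obj c.unop :=
  tensorLift (F := homFrom (𝟭 Cᵒᵖ) c) (G := G)
    (fun _ f y => G.obj.map (Quiver.Hom.unop (ULift.down f)) y)
    (fun d f g y =>
      map_add ((ofElement G d y).hom.app c.unop).hom ⟨f.down.unop⟩ ⟨g.down.unop⟩)
    (fun _ _ _ _ => map_add _ _ _)
    (fun _ _ f g y => LeftMod.map_comp_apply G f (Quiver.Hom.unop (ULift.down g)) y)

lemma id_tmul_bijective (c : Cᵒᵖ) : Function.Bijective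
    (fun y : G.obj.obj c.unop => (tmul (F := homFrom (𝟭 Cᵒᵖ) c) ⟨𝟙 c⟩ y)) := by
  refine Function.bijective_iff_has_inverse.2 ⟨homToTensorEval G c, fun y => ?_, ?_⟩
  · refine (tensorLift_tmul (F := homFrom (𝟭 Cᵒᵖ) c) _ _ _ _ (c := c.unop) ⟨𝟙 c⟩ y).trans ?_
    exact ConcreteCategory.congr_hom (G.obj.map_id c.unop) y
  · refine DFunLike.congr_fun (f := (tmulHom (homFrom (𝟭 Cᵒᵖ) c) G c.unop ⟨𝟙 c⟩).comp
      (homToTensorEval G c)) (g := AddMonoidHom.id _) (tensor_hom_ext fun d f y => ?_)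
    refine (congrArg (tmul (F := homFrom (𝟭 Cᵒᵖ) c) (c := c.unop) ⟨𝟙 c⟩)
      (tensorLift_tmul (F := homFrom (𝟭 Cᵒᵖ) c) _ _ _ _ f y)).trans ?_
    refine (tmul_balanced (F := homFrom (𝟭 Cᵒᵖ) c) (Quiver.Hom.unop (ULift.down f))
      ⟨𝟙 c⟩ y).symm.trans ?_
    exact congrArg (tmul · y) (ULift.ext _ _ (Category.id_comp _))

end CoYoneda

section Tor

lemma isZero_torMod_homFrom (F : RightMod.{v, u} C) (c : C) (n : ℕ) :
    IsZero (TorMod (n + 1) F (homFrom (𝟭 C) c)) := by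
  let R := projectiveResolution F
  refine (isZero_leftDerived_succ_iff (tensorRight (homFrom (𝟭 C) c)) R n).2 ?_
  refine (ShortComplex.ab_exact_iff_function_exact _).2 ?_
  refine (exact_iff_of_ladder (tmul_id_bijective _ c).2 (tmul_id_bijective _ c)
    (tmul_id_bijective _ c).1 (map_zero ((tmulHom _ (homFrom (𝟭 C) c) c).flip ⟨𝟙 c⟩))
    (fun _ => rfl) (fun _ => rfl)).1 ((LeftMod.exact_iff _ _).1 ⟨_, R.exact_succ n⟩ (op c))

instance (G : LeftMod.{v, u} C) : (tensorFunctor.obj G).Additive :=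
  inferInstanceAs (tensorRight G).Additive

instance (G : LeftMod.{v, u} C) : PreservesFiniteColimits (tensorFunctor.obj G) :=
  inferInstanceAs (PreservesFiniteColimits (tensorRight G))

section SecondVariable

variable (F : RightMod.{v, u} C) {S : ShortComplex (LeftMod.{v, u} C)}

lemma isZero_torMod_shift_iff (hS : S.ShortExact) {c : C} (h₂ : S.X₂ = homFrom (𝟭 C) c) (n : ℕ) :
    IsZero (TorMod (n + 2) F S.X₃) ↔ IsZero (TorMod (n + 1) F S.X₁) := by
  refine isZero_leftDerived_shift_iff_of_functor
    (S := .mk (tensorFunctor.map S.f) (tensorFunctor.map S.g) (S.map tensorFunctor).zero)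
    (fun P _ => shortExact_map_tensorFunctor hS P) F (fun n => ?_) n
  have := isZero_torMod_homFrom F c n
  rwa [← h₂] at this

lemma isZero_torMod_one_iff (hS : S.ShortExact) {c : C} (h₂ : S.X₂ = homFrom (𝟭 C) c) :
    IsZero (TorMod 1 F S.X₃) ↔ Mono ((tensorFunctor.flip.obj F).map S.f) := by
  refine isZero_leftDerived_one_iff_of_functor
    (S := .mk (tensorFunctor.map S.f) (tensorFunctor.map S.g) (S.map tensorFunctor).zero)
    (fun P _ => shortExact_map_tensorFunctor hS P) F ?_
  have := isZero_torMod_homFrom F c 0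
  rwa [← h₂] at this

end SecondVariable

theorem LeftMod.IsRepresentablePresentation.augmentedExact_map_iff {k : ℕ∞} {F : LeftMod.{v, u} C}
    {c : ℕ → C} {δ : ∀ i, c i ⟶ c (i + 1)} {x : F.obj.obj (c 0)}
    (hF : F.IsRepresentablePresentation k c δ x) (hk : 1 ≤ k)
    (T : LeftMod.{v, u} C ⥤ AddCommGrpCat.{u'}) [T.Additive] [PreservesFiniteColimits T]
    {Z : ℕ → ObjectProperty (LeftMod.{v, u} C)}
    (mono_iff : ∀ S : ShortComplex (LeftMod.{v, u} C), S.ShortExact →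
      (∃ c, S.X₂ = homFrom (𝟭 C) c) → (Z 1 S.X₃ ↔ Mono (T.map S.f)))
    (shift_iff : ∀ S : ShortComplex (LeftMod.{v, u} C), S.ShortExact →
      (∃ c, S.X₂ = homFrom (𝟭 C) c) → ∀ n, Z (n + 2) S.X₃ ↔ Z (n + 1) S.X₁)
    {D : Type*} [AddGroup D] (φ : T.obj F →+ D) :
    AugmentedExact k (A := fun i => T.obj (homFrom (𝟭 C) (c i)))
      (fun i => T.map (ofElement (homFrom (𝟭 C) (c i)) (c (i + 1)) ⟨δ i⟩))
      (φ ∘ T.map (ofElement F (c 0) x)) ↔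
    Function.Bijective φ ∧ ∀ i : ℕ, 1 ≤ i → (i : ℕ∞) < k → Z i F := by
  have hF' := LeftMod.isRepresentablePresentation_iff.1 hF
  let d (i : ℕ) : homFrom (𝟭 C) (c (i + 1)) ⟶ homFrom (𝟭 C) (c i) := ofElement _ _ ⟨δ i⟩
  have epi_ε : Epi (ofElement F (c 0) x) := (leftMod_epi_iff _).2 fun e => (hF' e).1
  have h₀ : ∃ w, (ShortComplex.mk (d 0) (ofElement F (c 0) x) w).Exact :=
    (LeftMod.exact_iff _ _).2 fun e => (hF' e).2.1 (Order.one_le_iff_pos.1 hk)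
  have h_succ (i : ℕ) (hi : ((i + 1 : ℕ) : ℕ∞) < k) :
      ∃ w, (ShortComplex.mk (d (i + 1)) (d i) w).Exact :=
    (LeftMod.exact_iff _ _).2 fun e => (hF' e).2.2 i hi
  refine AugmentedExact.comp_iff hk ((AddCommGrpCat.epi_iff_surjective _).1 inferInstance)
    ((ShortComplex.ab_exact_iff_function_exact _).1
      (h₀.choose_spec.map_of_epi_of_preservesCokernel T epi_ε inferInstance)) (fun i hi => ?_) φ
  refine (vanishing_iff_exact_map (𝒬 := fun Q => ∃ c, Q = homFrom (𝟭 C) c) (d := d) mono_iff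
    shift_iff i (fun j _ => ⟨c j, rfl⟩) epi_ε h₀ fun j hj => h_succ j ?_).trans ?_
  · exact lt_of_le_of_lt (by exact_mod_cast Nat.succ_le_succ hj) hi
  refine ⟨fun ⟨_, h⟩ => (ShortComplex.ab_exact_iff_function_exact _).1 h, fun h => ?_⟩
  obtain ⟨w, _⟩ := h_succ i hi
  exact ⟨by rw [← T.map_comp, w, T.map_zero], (ShortComplex.ab_exact_iff_function_exact _).2 h⟩

theorem LeftMod.IsRepresentablePresentation.augmentedExact_tensor_right_iff {k : ℕ∞}
    {F : RightMod.{v, u} C} {c : ℕ → Cᵒᵖ} {δ : ∀ i, c i ⟶ c (i + 1)} {x : F.obj.obj (c 0)}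
    (hF : F.IsRepresentablePresentation k c δ x) (hk : 1 ≤ k) (G : LeftMod.{v, u} C)
    {D : Type*} [AddGroup D] (φ : TensorObj F G →+ D) :
    AugmentedExact k (A := fun i => G.obj.obj (c i).unop) (fun i => G.obj.map (δ i).unop)
      (fun y => φ (tmul x y)) ↔
    Function.Bijective φ ∧ ∀ i : ℕ, 1 ≤ i → (i : ℕ∞) < k → IsZero (TorMod i F G) := by
  refine Iff.trans ?_ (hF.augmentedExact_map_iff hk (tensorRight G)
    (Z := fun i F => IsZero (TorMod i F G))
    (fun S hS ⟨c, hc⟩ => by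
      have : Projective S.X₂ := hc ▸ inferInstance
      exact isZero_leftDerived_one_iff _ hS)
    (fun S hS ⟨c, hc⟩ n => by
      have : Projective S.X₂ := hc ▸ inferInstance
      exact isZero_leftDerived_shift_iff _ hS n) φ)
  refine AugmentedExact.iff_of_ladder (fun i y => tmul (F := homFrom (𝟭 Cᵒᵖ) (c i)) ⟨𝟙 (c i)⟩ y)
    (β := id) (fun i _ => id_tmul_bijective G (c i))
    (fun i _ => map_zero (tmulHom (homFrom (𝟭 Cᵒᵖ) (c i)) G (c i).unop ⟨𝟙 (c i)⟩))
    Function.bijective_id rfl (fun i _ y => ?_) (fun y => ?_)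
  · refine (tmul_balanced (F := homFrom (𝟭 Cᵒᵖ) (c i)) (δ i).unop ⟨𝟙 _⟩ y).symm.trans ?_
    refine congrArg (tmul · y) (ULift.ext _ _ ?_)
    exact (Category.id_comp _).trans (Category.comp_id _).symm
  · exact congrArg φ (congrArg (tmul · y) (ConcreteCategory.congr_hom (F.obj.map_id (c 0)) x).symm)

theorem LeftMod.IsRepresentablePresentation.augmentedExact_tensor_left_iff {k : ℕ∞}
    {G : LeftMod.{v, u} C} {c : ℕ → C} {δ : ∀ i, c i ⟶ c (i + 1)} {y : G.obj.obj (c 0)}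
    (hG : G.IsRepresentablePresentation k c δ y) (hk : 1 ≤ k) (F : RightMod.{v, u} C)
    {D : Type*} [AddGroup D] (φ : TensorObj F G →+ D) :
    AugmentedExact k (A := fun i => F.obj.obj (op (c i))) (fun i => F.obj.map (δ i).op)
      (fun x => φ (tmul x y)) ↔
    Function.Bijective φ ∧ ∀ i : ℕ, 1 ≤ i → (i : ℕ∞) < k → IsZero (TorMod i F G) := by
  refine Iff.trans ?_ (hG.augmentedExact_map_iff hk (tensorFunctor.flip.obj F)
    (Z := fun i G => IsZero (TorMod i F G)) (fun S hS ⟨c, hc⟩ => isZero_torMod_one_iff F hS hc)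
    (fun S hS ⟨c, hc⟩ => isZero_torMod_shift_iff F hS hc) φ)
  refine AugmentedExact.iff_of_ladder (fun i x => tmul (G := homFrom (𝟭 C) (c i)) x ⟨𝟙 (c i)⟩)
    (β := id) (fun i _ => tmul_id_bijective F (c i))
    (fun i _ => map_zero ((tmulHom F (homFrom (𝟭 C) (c i)) (c i)).flip ⟨𝟙 (c i)⟩))
    Function.bijective_id rfl (fun i _ x => ?_) (fun x => ?_)
  · refine (tmul_balanced (G := homFrom (𝟭 C) (c i)) (δ i) x ⟨𝟙 _⟩).trans ?_
    refine congrArg (tmul x) (ULift.ext _ _ ?_)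
    exact (Category.id_comp _).trans (Category.comp_id _).symm
  · exact congrArg φ (congrArg (tmul x) (ConcreteCategory.congr_hom (G.obj.map_id (c 0)) y).symm)

end Tor

end Tensor

/-! ### Exact categories -/

section ExactCategories

variable {E : Type u} [Category.{v} E] [Preadditive E]

lemma hasKernel_of_splitting {T : ShortComplex E} (σ : T.Splitting) : HasKernel T.g :=
  HasLimit.mk ⟨KernelFork.ofι T.f T.zero, KernelFork.IsLimit.ofι _ _ (fun x _ => x ≫ σ.r)
    (fun x hx => by simp [σ.r_f, Preadditive.comp_sub, reassoc_of% hx])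
    fun x _ m hm => by simp [← hm]⟩

/-- A splitting, read from right to left. -/
def flipSplitting {T : ShortComplex E} (σ : T.Splitting) :
    (ShortComplex.mk σ.s σ.r σ.s_r).Splitting where
  r := T.g
  s := T.f
  id := by rw [add_comm, σ.id]

namespace ExactStructure

variable (S : ExactStructure E)

/-- The opposite exact structure. -/
def op : ExactStructure Eᵒᵖ where
  Conflation T := S.Conflation T.unop
  of_iso {T T'} e h := by
    let e' : T.unop ≅ T'.unop := ShortComplex.isoMk (ShortComplex.π₃.mapIso e).unop.symm
      (ShortComplex.π₂.mapIso e).unop.symm (ShortComplex.π₁.mapIso e).unop.symm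
      (congrArg Quiver.Hom.unop e.inv.comm₂₃.symm) (congrArg Quiver.Hom.unop e.inv.comm₁₂.symm)
    exact S.of_iso e' h
  isKernel {T} h := by
    obtain ⟨h⟩ := S.isCokernel h
    exact ⟨CokernelCofork.IsColimit.ofπOp _ _ h⟩
  isCokernel {T} h := by
    obtain ⟨h⟩ := S.isKernel h
    exact ⟨KernelFork.IsLimit.ofιOp _ _ h⟩
  id_inflation A := by
    obtain ⟨K, i, w, h⟩ := S.id_deflation A.unop
    exact ⟨.op K, i.op, Quiver.Hom.unop_inj w, h⟩
  id_deflation A := by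
    obtain ⟨K, i, w, h⟩ := S.id_inflation A.unop
    exact ⟨.op K, i.op, Quiver.Hom.unop_inj w, h⟩
  comp_inflation := by
    rintro A B C i j ⟨D, p, w, h⟩ ⟨D', p', w', h'⟩
    obtain ⟨K, q, w'', h''⟩ := S.comp_deflation j.unop i.unop
      ⟨_, p'.unop, Quiver.Hom.op_inj w', h'⟩ ⟨_, p.unop, Quiver.Hom.op_inj w, h⟩
    exact ⟨.op K, q.op, Quiver.Hom.unop_inj w'', h''⟩
  comp_deflation := by
    rintro A B C i j ⟨D, p, w, h⟩ ⟨D', p', w', h'⟩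
    obtain ⟨K, q, w'', h''⟩ := S.comp_inflation j.unop i.unop
      ⟨_, p'.unop, Quiver.Hom.op_inj w', h'⟩ ⟨_, p.unop, Quiver.Hom.op_inj w, h⟩
    exact ⟨.op K, q.op, Quiver.Hom.unop_inj w'', h''⟩
  pushout_inflation := by
    rintro A B A' i f ⟨D, p, w, h⟩
    obtain ⟨B', p', f', hp, K, j, w', h'⟩ := S.pullback_deflation i.unop f.unop
      ⟨_, p.unop, Quiver.Hom.op_inj w, h⟩
    exact ⟨.op B', p'.op, f'.op, hp.op.flip, .op K, j.op, Quiver.Hom.unop_inj w', h'⟩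
  pullback_deflation := by
    rintro A B A' i f ⟨D, p, w, h⟩
    obtain ⟨B', p', f', hp, K, j, w', h'⟩ := S.pushout_inflation i.unop f.unop
      ⟨_, p.unop, Quiver.Hom.op_inj w, h⟩
    exact ⟨.op B', p'.op, f'.op, hp.op.flip, .op K, j.op, Quiver.Hom.unop_inj w', h'⟩

variable {S}

lemma op_deflation_iff {A B : Eᵒᵖ} (p : A ⟶ B) : S.op.Deflation p ↔ S.Inflation p.unop := by
  constructor
  · rintro ⟨K, i, w, h⟩
    exact ⟨K.unop, i.unop, Quiver.Hom.op_inj w, h⟩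
  · rintro ⟨K, i, w, h⟩
    exact ⟨.op K, i.op, Quiver.Hom.unop_inj w, h⟩

lemma Deflation.epi {A B : E} {p : A ⟶ B} (h : S.Deflation p) : Epi p := by
  obtain ⟨K, i, w, h⟩ := h
  obtain ⟨h⟩ := S.isCokernel h
  exact epi_of_isColimit_cofork h

lemma Inflation.mono {A B : E} {i : A ⟶ B} (h : S.Inflation i) : Mono i := by
  obtain ⟨K, i, w, h⟩ := h
  obtain ⟨h⟩ := S.isKernel h
  exact mono_of_isLimit_fork h

lemma Conflation.exists_lift {T : ShortComplex E} (h : S.Conflation T) {W : E} (f : W ⟶ T.X₂)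
    (hf : f ≫ T.g = 0) : ∃ g : W ⟶ T.X₁, g ≫ T.f = f := by
  obtain ⟨h⟩ := S.isKernel h
  exact ⟨_, (KernelFork.IsLimit.lift' h f hf).2⟩

lemma Conflation.exists_desc {T : ShortComplex E} (h : S.Conflation T) {W : E} (f : T.X₂ ⟶ W)
    (hf : T.f ≫ f = 0) : ∃ g : T.X₃ ⟶ W, T.g ≫ g = f := by
  obtain ⟨h⟩ := S.isCokernel h
  exact ⟨_, (CokernelCofork.IsColimit.desc' h f hf).2⟩

lemma Deflation.of_arrow_iso {A B A' B' : E} {p : A ⟶ B} (h : S.Deflation p) {p' : A' ⟶ B'}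
    (a : A ≅ A') (b : B ≅ B') (w : p ≫ b.hom = a.hom ≫ p') : S.Deflation p' := by
  obtain ⟨K, i, w', h⟩ := h
  have w'' : (i ≫ a.hom) ≫ p' = 0 := by rw [Category.assoc, ← w, reassoc_of% w', zero_comp]
  let e : ShortComplex.mk i p w' ≅ ShortComplex.mk (i ≫ a.hom) p' w'' :=
    ShortComplex.isoMk (Iso.refl _) a b (by simp) w.symm
  exact ⟨K, i ≫ a.hom, w'', S.of_iso e h⟩

lemma Inflation.of_arrow_iso {A B A' B' : E} {i : A ⟶ B} (h : S.Inflation i) {i' : A' ⟶ B'}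
    (a : A ≅ A') (b : B ≅ B') (w : i ≫ b.hom = a.hom ≫ i') : S.Inflation i' := by
  obtain ⟨K, p, w', h⟩ := h
  have w'' : i' ≫ b.inv ≫ p = 0 := by
    rw [← cancel_epi a.hom, ← reassoc_of% w, b.hom_inv_id_assoc, w', comp_zero]
  let e : ShortComplex.mk i p w' ≅ ShortComplex.mk i' (b.inv ≫ p) w'' :=
    ShortComplex.isoMk a b (Iso.refl _) w.symm (by simp)
  exact ⟨K, b.inv ≫ p, w'', S.of_iso e h⟩

lemma Deflation.of_isPullback {B C B' C' : E} {p : B ⟶ C} (h : S.Deflation p) {f : C' ⟶ C}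
    {f' : B' ⟶ B} {p' : B' ⟶ C'} (hp : IsPullback f' p' p f) : S.Deflation p' := by
  obtain ⟨B'', p'', f'', hp', h'⟩ := S.pullback_deflation p f h
  exact Deflation.of_arrow_iso (p := p'') h' (hp'.isoIsPullback _ _ hp) (Iso.refl _) (by simp)

lemma Inflation.of_isPushout {A B A' B' : E} {i : A ⟶ B} (h : S.Inflation i) {f : A ⟶ A'}
    {i' : A' ⟶ B'} {f' : B ⟶ B'} (hp : IsPushout i f f' i') : S.Inflation i' := by
  obtain ⟨B'', i'', f'', hp', h'⟩ := S.pushout_inflation i f h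
  exact Inflation.of_arrow_iso (i := i'') h' (Iso.refl _) (hp'.isoIsPushout _ _ hp) (by simp)

lemma Deflation.comp {A B C : E} {p : A ⟶ B} {q : B ⟶ C} (hp : S.Deflation p)
    (hq : S.Deflation q) : S.Deflation (p ≫ q) := S.comp_deflation p q hp hq

lemma deflation_of_iso {A B : E} (e : A ≅ B) : S.Deflation e.hom :=
  Deflation.of_arrow_iso (S.id_deflation A) (Iso.refl _) e (by simp)

lemma Conflation.of_isPushout {T : ShortComplex E} (h : S.Conflation T) {A B : E} {a : T.X₁ ⟶ A}
    {i : A ⟶ B} {b : T.X₂ ⟶ B} (hp : IsPushout T.f a b i) {p : B ⟶ T.X₃} (hb : b ≫ p = T.g)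
    (w : i ≫ p = 0) : S.Conflation (ShortComplex.mk i p w) := by
  obtain ⟨D, q, wq, hq⟩ := Inflation.of_isPushout ⟨_, _, T.zero, h⟩ hp
  have := Deflation.epi ⟨_, _, wq, hq⟩
  have := Deflation.epi ⟨_, _, T.zero, h⟩
  obtain ⟨r, hr⟩ : ∃ r, q ≫ r = p := hq.exists_desc p w
  obtain ⟨t, ht⟩ : ∃ t, T.g ≫ t = b ≫ q :=
    h.exists_desc _ (by rw [reassoc_of% hp.w, wq, comp_zero])
  have hpt : p ≫ t = q :=
    hp.hom_ext (by rw [reassoc_of% hb, ht]) (by rw [reassoc_of% w, wq, zero_comp])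
  let e : D ≅ T.X₃ :=
    { hom := r
      inv := t
      hom_inv_id := by rw [← cancel_epi q, reassoc_of% hr, hpt, Category.comp_id]
      inv_hom_id := by rw [← cancel_epi T.g, reassoc_of% ht, hr, hb, Category.comp_id] }
  let φ : ShortComplex.mk i q wq ≅ ShortComplex.mk i p w :=
    ShortComplex.isoMk (Iso.refl _) (Iso.refl _) e (by simp) (by simpa [e] using hr.symm)
  exact S.of_iso φ hq

variable [HasBinaryBiproducts E]

lemma deflation_biprod_snd (A B : E) : S.Deflation (biprod.snd : A ⊞ B ⟶ B) := by
  obtain ⟨C, p, w, h⟩ := S.id_inflation A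
  have hp : p = 0 := by simpa using w
  refine Deflation.of_isPullback (p := p) (f := 0) (f' := biprod.fst) ⟨A, 𝟙 A, w, h⟩
    ⟨⟨by simp [hp]⟩, ⟨PullbackCone.IsLimit.mk _ (fun s => biprod.lift s.fst s.snd) (by simp)
      (by simp) fun s m h₁ h₂ => ?_⟩⟩
  ext <;> simp [h₁, h₂]

lemma Deflation.biprod_map_id {A C : E} {h : A ⟶ C} (hh : S.Deflation h) (B : E) :
    S.Deflation (biprod.map (𝟙 B) h) := by
  refine hh.of_isPullback (f := biprod.snd) (f' := biprod.snd) ⟨⟨by simp⟩,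
    ⟨PullbackCone.IsLimit.mk _ (fun s => biprod.lift (s.snd ≫ biprod.fst) s.fst) (by simp)
      (fun s => ?_) fun s m h₁ h₂ => ?_⟩⟩
  · ext <;> simp [s.condition]
  · ext
    · simp [← h₂]
    · simp [h₁]

lemma Deflation.biprod_desc {A B C : E} {h : A ⟶ C} (hh : S.Deflation h) (f : B ⟶ C) :
    S.Deflation (biprod.desc f h) := by
  let e : B ⊞ C ≅ B ⊞ C :=
    { hom := biprod.desc (biprod.lift (𝟙 _) f) biprod.inr
      inv := biprod.desc (biprod.lift (𝟙 _) (-f)) biprod.inr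
      hom_inv_id := by ext <;> simp
      inv_hom_id := by ext <;> simp }
  have : biprod.desc f h = biprod.map (𝟙 B) h ≫ e.hom ≫ biprod.snd := by
    ext <;> simp [e]
  rw [this]
  exact (hh.biprod_map_id B).comp ((deflation_of_iso e).comp (deflation_biprod_snd _ _))

lemma Deflation.fst_comp {A B C : E} {g : A ⟶ B} {f : B ⟶ C} (h : S.Deflation (g ≫ f)) :
    S.Deflation ((biprod.fst : B ⊞ A ⟶ B) ≫ f) := by
  let e : B ⊞ A ≅ B ⊞ A :=
    { hom := biprod.desc biprod.inl (biprod.lift (-g) (𝟙 _))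
      inv := biprod.desc biprod.inl (biprod.lift g (𝟙 _))
      hom_inv_id := by ext <;> simp
      inv_hom_id := by ext <;> simp }
  have : (biprod.fst : B ⊞ A ⟶ B) ≫ f = e.hom ≫ biprod.desc f (g ≫ f) := by
    ext <;> simp [e]
  rw [this]
  exact (deflation_of_iso e).comp (h.biprod_desc f)

lemma isPushout_biprod_fst {K N A B : E} {i : N ⟶ B ⊞ A} {κ : K ⟶ N}
    {w : κ ≫ i ≫ biprod.snd = 0} (σ : (ShortComplex.mk κ (i ≫ biprod.snd) w).Splitting)
    (hσ : σ.s ≫ i = biprod.inr) : IsPushout i σ.r biprod.fst (κ ≫ i ≫ biprod.fst) := by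
  have h_id : σ.r ≫ κ = 𝟙 N - i ≫ biprod.snd ≫ σ.s := by simpa using σ.r_f
  have h_retract : κ ≫ σ.r = 𝟙 K := σ.f_r
  have h_section : σ.s ≫ σ.r = 0 := σ.s_r
  have h_square : σ.r ≫ κ ≫ i ≫ biprod.fst = i ≫ biprod.fst := by
    rw [reassoc_of% h_id, Preadditive.sub_comp]
    simp [reassoc_of% hσ]
  have h_fst {W : E} {f : B ⊞ A ⟶ W} {g : K ⟶ W} (h : i ≫ f = σ.r ≫ g) :
      biprod.fst ≫ biprod.inl ≫ f = f := by
    have : biprod.inr ≫ f = 0 := by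
      rw [← hσ, Category.assoc, h, reassoc_of% h_section, zero_comp]
    ext <;> simp [this]
  refine ⟨⟨h_square.symm⟩, ⟨PushoutCocone.IsColimit.mk _ (fun t => biprod.inl ≫ t.inl)
    (fun t => h_fst t.condition) (fun t => ?_) fun t m h₁ _ => ?_⟩⟩
  · simp only [Category.assoc, h_fst t.condition]
    rw [t.condition, reassoc_of% h_retract]
  · simp [← h₁]

-- `A` splits off the kernel `N` of the deflation `B ⊞ A ⟶ C`, and pushing out along the projection
-- of `N` onto the complement turns this deflation into `f`.
theorem Deflation.of_comp (hE : WeaklyIdempotentComplete E) {A B C : E} {g : A ⟶ B} {f : B ⟶ C}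
    (h : S.Deflation (g ≫ f)) : S.Deflation f := by
  obtain ⟨N, i, w, hc⟩ := h.fst_comp
  obtain ⟨s, hs⟩ : ∃ s : A ⟶ N, s ≫ i = biprod.inr := hc.exists_lift _ (by simp)
  have hs' : s ≫ i ≫ biprod.snd = 𝟙 A := by rw [reassoc_of% hs, biprod.inr_snd]
  have := hE _ s hs'
  exact ⟨_, _, _, hc.of_isPushout (isPushout_biprod_fst (kernelSplitting hs') hs) (p := f) rfl
    (by simp [w])⟩

end ExactStructure

lemma WeaklyIdempotentComplete.op (hE : WeaklyIdempotentComplete E) :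
    WeaklyIdempotentComplete Eᵒᵖ := by
  intro A B r s h
  have h' : r.unop ≫ s.unop = 𝟙 _ := Quiver.Hom.op_inj h
  have := hE s.unop r.unop h'
  exact hasKernel_of_splitting (flipSplitting (kernelSplitting h')).op

end ExactCategories

section Sequences

variable {E : Type u} [Category.{v} E] [Preadditive E] {k : ℕ∞}

/-- Exactness of `Hom(N, A k) → ⋯ → Hom(N, A 0) → Hom(N, X) → 0`. -/
abbrev IsHomExactLeft (k : ℕ∞) {X : E} {A : ℕ → E} (a : A 0 ⟶ X) (d : ∀ i, A (i + 1) ⟶ A i)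
    (N : E) : Prop :=
  AugmentedExact k (A := fun i => N ⟶ A i) (fun i f => f ≫ d i) (fun f => f ≫ a)

/-- Exactness of `Hom(A k, N) → ⋯ → Hom(A 0, N) → Hom(X, N) → 0`. -/
abbrev IsHomExactRight (k : ℕ∞) {X : E} {A : ℕ → E} (a : X ⟶ A 0) (d : ∀ i, A i ⟶ A (i + 1))
    (N : E) : Prop :=
  AugmentedExact k (A := fun i => A i ⟶ N) (fun i f => d i ≫ f) (fun f => a ≫ f)

lemma isHomExactLeft_op_iff {X : E} {A : ℕ → E} {a : X ⟶ A 0} {d : ∀ i, A i ⟶ A (i + 1)} {N : E} :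
    IsHomExactLeft k (X := Opposite.op X) (A := fun i => Opposite.op (A i)) a.op
        (fun i => (d i).op) (Opposite.op N) ↔
      IsHomExactRight k a d N :=
  AugmentedExact.iff_of_ladder (fun _ => Quiver.Hom.unop) (β := Quiver.Hom.unop)
    (fun _ _ => Quiver.Hom.opEquiv.symm.bijective) (fun _ _ => rfl)
    Quiver.Hom.opEquiv.symm.bijective rfl (fun _ _ _ => rfl) (fun _ => rfl)

lemma exists_forall_mem_and_isHomExactLeft_iff {M : ObjectProperty E} {X : E} {A : ℕ → E}
    (hA : ∀ i : ℕ, (i : ℕ∞) ≤ k → M (A i)) (a : A 0 ⟶ X) (d : ∀ i, A (i + 1) ⟶ A i) :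
    ∃ (A' : ℕ → E) (a' : A' 0 ⟶ X) (d' : ∀ i, A' (i + 1) ⟶ A' i), (∀ i, M (A' i)) ∧
      ∀ N, IsHomExactLeft k a d N ↔ IsHomExactLeft k a' d' N := by
  have h_replace (i : ℕ) : ∃ (B : E) (u : B ⟶ A i) (v : A i ⟶ B), M B ∧
      ((i : ℕ∞) ≤ k → u ≫ v = 𝟙 B ∧ v ≫ u = 𝟙 (A i)) := by
    by_cases hi : (i : ℕ∞) ≤ k
    · exact ⟨A i, 𝟙 _, 𝟙 _, hA i hi, by simp⟩
    · exact ⟨A 0, 0, 0, hA 0 (by simp), fun h => absurd h hi⟩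
  choose B u v hB huv using h_replace
  refine ⟨B, u 0 ≫ a, fun i => u (i + 1) ≫ d i ≫ v i, hB, fun N => ?_⟩
  refine AugmentedExact.iff_of_ladder (fun i f => f ≫ v i) (β := id) (fun i hi => ?_)
    (fun _ _ => zero_comp) Function.bijective_id rfl (fun i hi f => ?_) (fun f => ?_)
  · exact Function.bijective_iff_has_inverse.2 ⟨fun f => f ≫ u i,
      fun f => by simp [(huv i hi).2], fun f => by simp [(huv i hi).1]⟩
  · simp [reassoc_of% (huv (i + 1) hi).2]
  · simp [reassoc_of% (huv 0 (by simp)).2]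

namespace ExactStructure

variable {S : ExactStructure E}

lemma LeftSequence.isHomExactLeft {X : E} (T : S.LeftSequence k X) {P : E}
    (hP : S.IsProjective P) : IsHomExactLeft k T.aug T.d P := by
  have h_mono {i : ℕ} (hi : (i : ℕ∞) < k) : Mono (T.ι i) :=
    Inflation.mono ⟨_, _, _, T.conflation i hi.le⟩
  have h_splice := AugmentedExact.of_splice (k := k) (A := fun i => P ⟶ T.A i)
    (Z := fun i => P ⟶ T.Z i) (ι := fun i f => f ≫ T.ι i) (π := fun i f => f ≫ T.π i)
    (fun i hi f g hfg => (h_mono hi).right_cancellation f g hfg) (fun _ _ => zero_comp)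
    (fun i hi => hP _ ⟨_, _, _, T.conflation i hi⟩)
    (fun i hi f => ⟨(T.conflation i hi.le).exists_lift f, by rintro ⟨g, rfl⟩; simp [T.w]⟩)
  refine (AugmentedExact.iff_of_ladder (fun _ => id) (β := fun f => f ≫ T.e.hom)
    (fun _ _ => Function.bijective_id) (fun _ _ => rfl) ?_ zero_comp
    (fun i _ f => by simp [LeftSequence.d]) (fun f => by simp [LeftSequence.aug])).1 h_splice
  exact Function.bijective_iff_has_inverse.2 ⟨fun f => f ≫ T.e.inv, fun f => by simp,
    fun f => by simp⟩

section EnoughProjectives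

variable [HasBinaryBiproducts E]

lemma deflation_of_surjective (hE : WeaklyIdempotentComplete E) (hS : S.HasEnoughProjectives)
    {A B : E} {p : A ⟶ B}
    (h : ∀ P, S.IsProjective P → Function.Surjective (fun f : P ⟶ A => f ≫ p)) :
    S.Deflation p := by
  obtain ⟨P, q, hP, hq⟩ := hS B
  obtain ⟨g, rfl⟩ := h P hP q
  exact hq.of_comp hE

lemma exists_conflation_of_exact (hE : WeaklyIdempotentComplete E) (hS : S.HasEnoughProjectives)
    {A B Z : E} {m : A ⟶ B} {π : B ⟶ Z} (hπ : S.Deflation π)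
    (h : ∀ P, S.IsProjective P →
      Function.Exact (fun f : P ⟶ A => f ≫ m) (fun f : P ⟶ B => f ≫ π)) :
    ∃ (K : E) (ι : K ⟶ B) (w : ι ≫ π = 0) (π' : A ⟶ K),
      S.Conflation (ShortComplex.mk ι π w) ∧ S.Deflation π' ∧ π' ≫ ι = m := by
  obtain ⟨K, ι, w, hc⟩ := hπ
  have hm : m ≫ π = 0 := by
    obtain ⟨P, p, hP, hp⟩ := hS A
    have := hp.epi
    rw [← cancel_epi p, ← Category.assoc, comp_zero]
    exact (h P hP _).2 ⟨p, rfl⟩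
  obtain ⟨π', hπ'⟩ : ∃ π', π' ≫ ι = m := hc.exists_lift m hm
  have : Mono ι := Inflation.mono ⟨_, _, _, hc⟩
  refine ⟨K, ι, w, π', hc, deflation_of_surjective hE hS fun P hP f => ?_, hπ'⟩
  obtain ⟨g, hg⟩ := (h P hP (f ≫ ι)).1 (by simp [w])
  exact ⟨g, by simpa [← cancel_mono ι, hπ'] using hg⟩

variable {X : E} {A : ℕ → E} {a : A 0 ⟶ X} {d : ∀ i, A (i + 1) ⟶ A i}

variable (k S d) in
/-- If `i ≤ k`, then `π : A i ⟶ Z` can serve as the deflation onto the `i`-th syzygy in an exact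
sequence `0 → Z (k+1) → A k → ⋯ → A 0 → X → 0` with differentials `d`. -/
structure IsSyzygyMap (i : ℕ) {Z : E} (π : A i ⟶ Z) : Prop where
  deflation : (i : ℕ∞) ≤ k → S.Deflation π
  exact : (i : ℕ∞) < k → ∀ P, S.IsProjective P →
    Function.Exact (fun f : P ⟶ A (i + 1) => f ≫ d i) (fun f : P ⟶ A i => f ≫ π)

lemma IsSyzygyMap.exists_succ (hE : WeaklyIdempotentComplete E) (hS : S.HasEnoughProjectives)
    (h : ∀ P, S.IsProjective P → IsHomExactLeft k a d P) {i : ℕ} {Z : E} {π : A i ⟶ Z}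
    (hπ : IsSyzygyMap k S d i π) :
    ∃ (K : E) (ι : K ⟶ A i) (w : ι ≫ π = 0) (π' : A (i + 1) ⟶ K),
      ((i : ℕ∞) ≤ k → S.Conflation (ShortComplex.mk ι π w)) ∧ IsSyzygyMap k S d (i + 1) π' ∧
        (((i + 1 : ℕ) : ℕ∞) ≤ k → π' ≫ ι = d i) := by
  by_cases hi : ((i + 1 : ℕ) : ℕ∞) ≤ k
  · have hik : (i : ℕ∞) < k := lt_of_lt_of_le (by exact_mod_cast Nat.lt_succ_self i) hi
    obtain ⟨K, ι, w, π', hc, hπ', hι⟩ :=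
      exists_conflation_of_exact hE hS (hπ.deflation hik.le) (hπ.exact hik)
    have : Mono ι := Inflation.mono ⟨_, _, _, hc⟩
    refine ⟨K, ι, w, π', fun _ => hc, ⟨fun _ => hπ', fun hi P hP => ?_⟩, fun _ => hι⟩
    refine (exact_comp_iff_of_injective (c := fun f => f ≫ ι)
      (fun _ _ => (cancel_mono ι).1) zero_comp).1 ?_
    simpa only [Function.comp_def, Category.assoc, hι] using (h P hP).2.2 i hi
  · have h_syzygy (K : E) : IsSyzygyMap k S d (i + 1) (0 : A (i + 1) ⟶ K) :=
      ⟨fun h => absurd h hi, fun h => absurd h.le hi⟩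
    by_cases hi' : (i : ℕ∞) ≤ k
    · obtain ⟨K, ι, w, hc⟩ := hπ.deflation hi'
      exact ⟨K, ι, w, 0, fun _ => hc, h_syzygy K, fun h => absurd h hi⟩
    · exact ⟨Z, 0, zero_comp, 0, fun h => absurd h hi', h_syzygy Z, fun h => absurd h hi⟩

lemma exists_leftSequence (hE : WeaklyIdempotentComplete E) (hS : S.HasEnoughProjectives)
    (h : ∀ P, S.IsProjective P → IsHomExactLeft k a d P) :
    ∃ T : S.LeftSequence k X, T.A = A ∧
      ∀ N, IsHomExactLeft k a d N ↔ IsHomExactLeft k T.aug T.d N := by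
  have ha : IsSyzygyMap k S d 0 a :=
    ⟨fun _ => deflation_of_surjective hE hS fun P hP => (h P hP).1, fun hk P hP => (h P hP).2.1 hk⟩
  choose K ι w π' hc hπ' hι using fun (i : ℕ) (s : { s : Σ Z : E, A i ⟶ Z //
    IsSyzygyMap k S d i s.2 }) => s.2.exists_succ hE hS h
  let s (i : ℕ) : { s : Σ Z : E, A i ⟶ Z // IsSyzygyMap k S d i s.2 } :=
    Nat.rec ⟨⟨X, a⟩, ha⟩ (fun i s => ⟨⟨K i s, π' i s⟩, hπ' i s⟩) i
  let T : S.LeftSequence k X :=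
    { A := A
      Z := fun i => (s i).1.1
      e := Iso.refl X
      ι := fun i => ι i (s i)
      π := fun i => (s i).1.2
      w := fun i => w i (s i)
      conflation := fun i => hc i (s i) }
  have h_aug : T.aug = a := Category.comp_id a
  have h_d (i : ℕ) (hi : ((i + 1 : ℕ) : ℕ∞) ≤ k) : T.d i = d i := hι i (s i) hi
  exact ⟨T, rfl, fun N => AugmentedExact.iff_of_ladder (fun _ => id) (β := id)
    (fun _ _ => Function.bijective_id) (fun _ _ => rfl) Function.bijective_id rfl
    (fun i hi f => congrArg (f ≫ ·) (h_d i hi).symm) (fun f => congrArg (f ≫ ·) h_aug.symm)⟩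

theorem gen_iff (hE : WeaklyIdempotentComplete E) (hS : S.HasEnoughProjectives)
    (M : ObjectProperty E) (X : E) : S.gen k M X ↔
      ∃ (A : ℕ → E) (a : A 0 ⟶ X) (d : ∀ i, A (i + 1) ⟶ A i), (∀ i, M (A i)) ∧
        (∀ N, M N → IsHomExactLeft k a d N) ∧ ∀ P, S.IsProjective P → IsHomExactLeft k a d P := by
  constructor
  · rintro ⟨T, hT, h⟩
    obtain ⟨A, a, d, hA, h_iff⟩ := exists_forall_mem_and_isHomExactLeft_iff hT T.aug T.d
    exact ⟨A, a, d, hA, fun N hN => (h_iff N).1 (h N hN),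
      fun P hP => (h_iff P).1 (T.isHomExactLeft hP)⟩
  · rintro ⟨A, a, d, hA, hM, hP⟩
    obtain ⟨T, rfl, h_iff⟩ := exists_leftSequence hE hS hP
    exact ⟨T, fun i _ => hA i, fun N hN => (h_iff N).1 (hM N hN)⟩

end EnoughProjectives

lemma op_isProjective_iff {P : Eᵒᵖ} : S.op.IsProjective P ↔ S.IsInjective P.unop := by
  constructor
  · intro h A B i hi f
    obtain ⟨g, hg⟩ := h i.op (op_deflation_iff _ |>.2 hi) f.op
    exact ⟨g.unop, congrArg Quiver.Hom.unop hg⟩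
  · intro h A B i hi f
    obtain ⟨g, hg⟩ := h i.unop ((op_deflation_iff _).1 hi) f.unop
    exact ⟨g.op, congrArg Quiver.Hom.op hg⟩

lemma HasEnoughInjectives.op (h : S.HasEnoughInjectives) : S.op.HasEnoughProjectives := by
  intro X
  obtain ⟨I, i, hI, hi⟩ := h X.unop
  exact ⟨.op I, i.op, op_isProjective_iff.2 hI, (op_deflation_iff _).2 hi⟩

lemma op_gen_iff (M : ObjectProperty E) (X : E) :
    S.op.gen k M.op (.op X) ↔ S.cogen k M X := by
  constructor
  · rintro ⟨T, hT, h⟩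
    let T' : S.RightSequence k X :=
      { A := fun i => (T.A i).unop
        Z := fun i => (T.Z i).unop
        e := T.e.unop
        ι := fun i => (T.π i).unop
        π := fun i => (T.ι i).unop
        w := fun i => congrArg Quiver.Hom.unop (T.w i)
        conflation := T.conflation }
    exact ⟨T', hT, fun N hN =>
      isHomExactLeft_op_iff (a := T'.coaug) (d := T'.d).1 (h (.op N) hN)⟩
  · rintro ⟨T, hT, h⟩
    let T' : S.op.LeftSequence k (.op X) :=
      { A := fun i => .op (T.A i)
        Z := fun i => .op (T.Z i)
        e := T.e.op
        ι := fun i => (T.π i).op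
        π := fun i => (T.ι i).op
        w := fun i => congrArg Quiver.Hom.op (T.w i)
        conflation := T.conflation }
    exact ⟨T', hT, fun N hN =>
      isHomExactLeft_op_iff (a := T.coaug) (d := T.d).2 (h N.unop hN)⟩

theorem cogen_iff [HasBinaryBiproducts E] (hE : WeaklyIdempotentComplete E)
    (hS : S.HasEnoughInjectives) (M : ObjectProperty E) (X : E) : S.cogen k M X ↔
      ∃ (A : ℕ → E) (a : X ⟶ A 0) (d : ∀ i, A i ⟶ A (i + 1)), (∀ i, M (A i)) ∧
        (∀ N, M N → IsHomExactRight k a d N) ∧ ∀ I, S.IsInjective I → IsHomExactRight k a d I := by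
  rw [← op_gen_iff, gen_iff hE.op hS.op]
  constructor
  · rintro ⟨A, a, d, hA, hM, hI⟩
    exact ⟨fun i => (A i).unop, a.unop, fun i => (d i).unop, hA,
      fun N hN => isHomExactLeft_op_iff.1 (hM (.op N) hN),
      fun I h => isHomExactLeft_op_iff.1 (hI (.op I) (op_isProjective_iff.2 h))⟩
  · rintro ⟨A, a, d, hA, hM, hI⟩
    exact ⟨fun i => .op (A i), a.op, fun i => (d i).op, hA,
      fun N hN => isHomExactLeft_op_iff.2 (hM N.unop hN),
      fun I h => isHomExactLeft_op_iff.2 (hI I.unop (op_isProjective_iff.1 h))⟩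

end ExactStructure

end Sequences

/-! ### Presentations of `Φ(X)` and `Ψ(X)` -/

section Characterization

open Opposite

variable {E : Type u} [Category.{v} E] [Preadditive E] {M : ObjectProperty E} {k : ℕ∞} {X : E}

lemma compositionMap_tmul {Y : E} {N : M.FullSubcategory} (g : (Phi M X).obj.obj (op N))
    (f : (Psi M Y).obj.obj N) : compositionMap M X Y (tmul g f) = f.down ≫ g.down :=
  tensorLift_tmul ..

lemma phi_isRepresentablePresentation_iff {c : ℕ → M.FullSubcategoryᵒᵖ}
    {δ : ∀ i, c i ⟶ c (i + 1)} {x : (Phi M X).obj.obj (c 0)} :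
    (Phi M X).IsRepresentablePresentation k c δ x ↔
      ∀ N, M N → IsHomExactLeft k (A := fun i => (c i).unop.obj) x.down
        (fun i => (δ i).unop.hom) N := by
  have h_iff (N : M.FullSubcategory) :=
    AugmentedExact.iff_of_ladder (k := k) (A := fun i => c i ⟶ op N)
      (A' := fun i => N.obj ⟶ (c i).unop.obj) (d := fun i f => δ i ≫ f)
      (ε := fun f => (Phi M X).obj.map f x) (d' := fun i f => f ≫ (δ i).unop.hom)
      (ε' := fun f => f ≫ x.down) (fun _ f => f.unop.hom) (β := ULift.down)
      (fun _ _ => (M.fullyFaithfulι.homEquiv.bijective).comp Quiver.Hom.opEquiv.symm.bijective)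
      (fun _ _ => rfl) Equiv.ulift.bijective rfl (fun _ _ _ => rfl) (fun _ => rfl)
  exact ⟨fun h N hN => (h_iff ⟨N, hN⟩).1 (h _), fun h N => (h_iff N.unop).2 (h _ N.unop.property)⟩

lemma psi_isRepresentablePresentation_iff {c : ℕ → M.FullSubcategory}
    {δ : ∀ i, c i ⟶ c (i + 1)} {x : (Psi M X).obj.obj (c 0)} :
    (Psi M X).IsRepresentablePresentation k c δ x ↔
      ∀ N, M N → IsHomExactRight k (A := fun i => (c i).obj) x.down (fun i => (δ i).hom) N := by
  have h_iff (N : M.FullSubcategory) :=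
    AugmentedExact.iff_of_ladder (k := k) (A := fun i => c i ⟶ N)
      (A' := fun i => (c i).obj ⟶ N.obj) (d := fun i f => δ i ≫ f)
      (ε := fun f => (Psi M X).obj.map f x) (d' := fun i f => (δ i).hom ≫ f)
      (ε' := fun f => x.down ≫ f) (fun _ f => f.hom) (β := ULift.down)
      (fun _ _ => M.fullyFaithfulι.homEquiv.bijective)
      (fun _ _ => rfl) Equiv.ulift.bijective rfl (fun _ _ _ => rfl) (fun _ => rfl)
  exact ⟨fun h N hN => (h_iff ⟨N, hN⟩).1 (h _), fun h N => (h_iff N).2 (h _ N.property)⟩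

lemma isHomExactLeft_iff_bijective_compositionMap (hk : 1 ≤ k) {c : ℕ → M.FullSubcategoryᵒᵖ}
    {δ : ∀ i, c i ⟶ c (i + 1)} {x : (Phi M X).obj.obj (c 0)}
    (h : (Phi M X).IsRepresentablePresentation k c δ x) (P : E) :
    IsHomExactLeft k (A := fun i => (c i).unop.obj) x.down (fun i => (δ i).unop.hom) P ↔
      Function.Bijective (compositionMap M X P) ∧
        ∀ i : ℕ, 1 ≤ i → (i : ℕ∞) < k → IsZero (TorMod i (Phi M X) (Psi M P)) := by
  rw [← h.augmentedExact_tensor_right_iff hk]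
  exact AugmentedExact.iff_of_ladder (fun _ => ULift.up) (β := id)
    (fun _ _ => Equiv.ulift.symm.bijective) (fun _ _ => rfl) Function.bijective_id rfl
    (fun _ _ _ => rfl) (fun f => (compositionMap_tmul (N := (c 0).unop) x ⟨f⟩).symm)

lemma isHomExactRight_iff_bijective_compositionMap (hk : 1 ≤ k) {c : ℕ → M.FullSubcategory}
    {δ : ∀ i, c i ⟶ c (i + 1)} {x : (Psi M X).obj.obj (c 0)}
    (h : (Psi M X).IsRepresentablePresentation k c δ x) (I : E) :
    IsHomExactRight k (A := fun i => (c i).obj) x.down (fun i => (δ i).hom) I ↔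
      Function.Bijective (compositionMap M I X) ∧
        ∀ i : ℕ, 1 ≤ i → (i : ℕ∞) < k → IsZero (TorMod i (Phi M I) (Psi M X)) := by
  rw [← h.augmentedExact_tensor_left_iff hk]
  exact AugmentedExact.iff_of_ladder (fun _ => ULift.up) (β := id)
    (fun _ _ => Equiv.ulift.symm.bijective) (fun _ _ => rfl) Function.bijective_id rfl
    (fun _ _ _ => rfl) (fun f => (compositionMap_tmul (X := I) ⟨f⟩ x).symm)

namespace ExactStructure

variable {S : ExactStructure E} [HasBinaryBiproducts E] [HasFiniteBiproducts M.FullSubcategory]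

theorem gen_iff_isPresented_phi (hE : WeaklyIdempotentComplete E) (hS : S.HasEnoughProjectives)
    (hk : 1 ≤ k) : S.gen k M X ↔ (Phi M X).IsPresented k ∧
      ∀ P : E, S.IsProjective P → Function.Bijective (compositionMap M X P) ∧
        ∀ i : ℕ, 1 ≤ i → (i : ℕ∞) < k → IsZero (TorMod i (Phi M X) (Psi M P)) := by
  rw [gen_iff hE hS]
  constructor
  · rintro ⟨A, a, d, hA, hM, hP⟩
    have hp := (phi_isRepresentablePresentation_iff (M := M) (c := fun i => .op ⟨A i, hA i⟩)
      (δ := fun i => (ObjectProperty.homMk (d i)).op) (x := ⟨a⟩)).2 hM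
    exact ⟨hp.isPresented, fun P h =>
      (isHomExactLeft_iff_bijective_compositionMap hk hp P).1 (hP P h)⟩
  · rintro ⟨hp, hP⟩
    have : HasFiniteBiproducts M.FullSubcategoryᵒᵖ := .of_hasFiniteProducts
    obtain ⟨c, δ, x, hp⟩ := hp.exists_isRepresentablePresentation
    exact ⟨_, _, _, fun i => (c i).unop.property, phi_isRepresentablePresentation_iff.1 hp,
      fun P h => (isHomExactLeft_iff_bijective_compositionMap hk hp P).2 (hP P h)⟩

theorem cogen_iff_isPresented_psi (hE : WeaklyIdempotentComplete E) (hS : S.HasEnoughInjectives)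
    (hk : 1 ≤ k) : S.cogen k M X ↔ (Psi M X).IsPresented k ∧
      ∀ I : E, S.IsInjective I → Function.Bijective (compositionMap M I X) ∧
        ∀ i : ℕ, 1 ≤ i → (i : ℕ∞) < k → IsZero (TorMod i (Phi M I) (Psi M X)) := by
  rw [cogen_iff hE hS]
  constructor
  · rintro ⟨A, a, d, hA, hM, hI⟩
    have hp := (psi_isRepresentablePresentation_iff (M := M) (c := fun i => ⟨A i, hA i⟩)
      (δ := fun i => ObjectProperty.homMk (d i)) (x := ⟨a⟩)).2 hM
    exact ⟨hp.isPresented, fun I h =>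
      (isHomExactRight_iff_bijective_compositionMap hk hp I).1 (hI I h)⟩
  · rintro ⟨hp, hI⟩
    obtain ⟨c, δ, x, hp⟩ := hp.exists_isRepresentablePresentation
    exact ⟨_, _, _, fun i => (c i).property, psi_isRepresentablePresentation_iff.1 hp,
      fun I h => (isHomExactRight_iff_bijective_compositionMap hk hp I).2 (hI I h)⟩

end ExactStructure

end Characterization

theorem mainTheorem3 {E : Type u} [Category.{v} E] [Preadditive E] [HasFiniteBiproducts E]
    (S : ExactStructure E) (hE : WeaklyIdempotentComplete E)
    (M : ObjectProperty E) [HasFiniteBiproducts M.FullSubcategory]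
    (k : ℕ∞) (hk : 1 ≤ k) (X : E) :
    (S.HasEnoughProjectives →
      (S.gen k M X ↔
        (Phi M X).IsPresented k ∧
        ∀ P : E, S.IsProjective P →
          Function.Bijective (compositionMap M X P) ∧
          ∀ i : ℕ, 1 ≤ i → (i : ℕ∞) < k → IsZero (TorMod i (Phi M X) (Psi M P)))) ∧
    (S.HasEnoughInjectives →
      (S.cogen k M X ↔
        (Psi M X).IsPresented k ∧
        ∀ I : E, S.IsInjective I →
          Function.Bijective (compositionMap M I X) ∧
          ∀ i : ℕ, 1 ≤ i → (i : ℕ∞) < k → IsZero (TorMod i (Phi M I) (Psi M X)))) := by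
  have := hasBinaryBiproducts_of_finite_biproducts E
  exact ⟨fun hS => ExactStructure.gen_iff_isPresented_phi hE hS hk,
    fun hS => ExactStructure.cogen_iff_isPresented_psi hE hS hk⟩
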